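/- For $\nu\in\mathbb C$ and $-1<x\le 1$ let $P_\nu(x)={}_2F_1\!\left(-\nu,\nu+1;1;\tfrac{1-x}{2}\right)$ be the Legendre function of the first kind. For $-1<x<1$ let $$Q_\nu(x)=\frac{\pi}{2\sin(\nu\pi)}\bigl[\cos(\nu\pi)P_\nu(x)-P_\nu(-x)\bigr]\quad(\nu\in\mathbb C\smallsetminus\mathbb Z),\qquad Q_n(x)=\lim_{\nu\to n}Q_\nu(x)\quad(n\in\mathbb Z_{\ge 0})$$ be the Legendre functions of the second kind. For $-1<x<1$ write $\mathcal P\int_{-1}^1 f(\xi)\,d\xi=\lim_{\varepsilon\to0^+}\int_{(-1,1)\smallsetminus[x-\varepsilon,x+\varepsilon]}f(\xi)\,d\xi$ for the Cauchy principal value at $\xi=x$. **Proposition (Tricomi transform of $P_\nu(\xi)P_\nu(-\xi)$).** For every $\nu\in\mathbb C\smallsetminus\mathbb Z$ and $-1<x<1$, $$\mathcal P\int_{-1}^1\frac{2P_\nu(\xi)P_\nu(-\xi)}{\pi(x-\xi)}\,d\xi=\frac{[P_\nu(x)]^2-[P_\nu(-x)]^2}{\sin(\nu\pi)}.$$ For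 every integer $n\ge 0$ and $-1<x<1$, $$\mathcal P\int_{-1}^1\frac{[P_n(\xi)]^2}{2(x-\xi)}\,d\xi=\mathcal P\int_{-1}^1\frac{[P_{-n-1}(\xi)]^2}{2(x-\xi)}\,d\xi=P_n(x)\,Q_n(x).$$ In particular all principal values above, and the limit defining $Q_n(x)$, exist. -/

import Mathlib

/-- The Legendre function of the first kind `P_ν(x)` of complex degree `ν`, for `-1 < x ≤ 1`:
the Gauss hypergeometric series `₂F₁(-ν, ν + 1; 1; (1 - x) / 2)`. -/
noncomputable def legendreP (ν : ℂ) (x : ℝ) : ℂ :=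
  ordinaryHypergeometric (-ν) (ν + 1) (1 : ℂ) ((1 - (x : ℂ)) / 2)

/-- The Legendre function of the second kind `Q_ν(x)` of non-integer degree `ν`,
for `-1 < x < 1`. -/
noncomputable def legendreQ (ν : ℂ) (x : ℝ) : ℂ :=
  (Real.pi : ℂ) / (2 * Complex.sin (ν * Real.pi)) *
    (Complex.cos (ν * Real.pi) * legendreP ν x - legendreP ν (-x))

/-- The Legendre function of the second kind `Q_n(x)` of degree `n = 0, 1, 2, …`,
for `-1 < x < 1`: the limit of `Q_ν(x)` as `ν → n`, `ν ≠ n`. -/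
noncomputable def legendreQNat (n : ℕ) (x : ℝ) : ℂ :=
  Filter.limUnder (nhdsWithin (n : ℂ) {(n : ℂ)}ᶜ) (fun ν : ℂ => legendreQ ν x)

/-- The Cauchy principal value of `∫_a^b f(ξ) dξ` with respect to the point `c` exists and
equals `I`: off every symmetric neighbourhood of `c` the function `f` is Lebesgue integrable, and
the integrals over `(a, b) ∖ [c - ε, c + ε]` tend to `I` as `ε → 0⁺`. -/
def HasPrincipalValue (f : ℝ → ℂ) (a b c : ℝ) (I : ℂ) : Prop :=
  (∀ ε : ℝ, 0 < ε →
    MeasureTheory.IntegrableOn f (Set.Ioo a b \ Set.Icc (c - ε) (c + ε))) ∧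
  Filter.Tendsto (fun ε : ℝ => ∫ ξ in Set.Ioo a b \ Set.Icc (c - ε) (c + ε), f ξ)
    (nhdsWithin 0 (Set.Ioi 0)) (nhds I)

/-!
The product `w(ξ) = P_ν(ξ) P_ν(-ξ)` solves the symmetric square of Legendre's equation. The
coefficients of that system are quadratic polynomials, so multiplying by them commutes with the
Cauchy transform up to terms of finite rank, which can be absorbed into the other two components.
Hence off the segment `[-1, 1]` the Cauchy transform `G` of `w` is again the first component of a
solution of the symmetric square.
Pairing this solution with two solutions of Legendre's equation gives a constant. Taking the pairs
`(P_ν(z), P_ν(z))`, `(P_ν(-z), P_ν(-z))` and `(P_ν(z), P_ν(-z))`, the first two constants can be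
read off at the endpoints `z = 1` and `z = -1`, and the Wronskian of `P_ν(z)` and `P_ν(-z)` then
expresses `G` in the upper half plane as
`π / (2 sin νπ) (P_ν(z)² - P_ν(-z)²) + b P_ν(z) P_ν(-z)`.
Adding the boundary values of `G` from above and below leaves twice the principal value, and the
unknown `b` cancels because `G` is odd while `P_ν(z) P_ν(-z)` is even. The principal value is
continuous in `ν`, so integer degrees follow by letting `ν → n`, where
`P_n(-x) = (-1)ⁿ P_n(x)`.
-/

open Filter Topology MeasureTheory Set
open scoped Interval

theorem summable_mul_pow_of_norm_le {c : ℕ → ℂ} {K : ℝ} (hc : ∀ n, ‖c n‖ ≤ K) {s : ℂ}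
    (hs : ‖s‖ < 1) : Summable fun n => c n * s ^ n := by
  refine .of_norm_bounded ((summable_geometric_of_lt_one (norm_nonneg s) hs).mul_left K) fun n => ?_
  rw [norm_mul, norm_pow]
  gcongr
  exact hc n

theorem norm_mul_pow_le_of_mem_ball {c : ℕ → ℂ} {K : ℝ} (hc : ∀ n, ‖c n‖ ≤ K) {r : ℝ} (n : ℕ)
    {s : ℂ} (hs : s ∈ Metric.ball 0 r) : ‖c n * s ^ n‖ ≤ K * r ^ n := by
  have hsr : ‖s‖ ≤ r := (mem_ball_zero_iff.mp hs).le
  have hK : 0 ≤ K := (norm_nonneg _).trans (hc 0)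
  rw [norm_mul, norm_pow]
  gcongr
  exact hc n

theorem differentiableAt_tsum_mul_pow {c : ℕ → ℂ} {K : ℝ} (hc : ∀ n, ‖c n‖ ≤ K) {s : ℂ}
    (hs : ‖s‖ < 1) : DifferentiableAt ℂ (fun s => ∑' n, c n * s ^ n) s := by
  obtain ⟨r, hsr, hr⟩ := exists_between hs
  have hgeom := (summable_geometric_of_lt_one ((norm_nonneg s).trans hsr.le) hr).mul_left K
  exact (Complex.differentiableOn_tsum_of_summable_norm hgeom (fun n => by fun_prop)
    Metric.isOpen_ball fun n _ => norm_mul_pow_le_of_mem_ball hc n).differentiableAt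
    (Metric.isOpen_ball.mem_nhds (mem_ball_zero_iff.mpr hsr))

theorem hasSum_deriv_tsum_mul_pow {c : ℕ → ℂ} {K : ℝ} (hc : ∀ n, ‖c n‖ ≤ K) {s : ℂ}
    (hs : ‖s‖ < 1) :
    HasSum (fun n => c n * (n * s ^ (n - 1))) (deriv (fun s => ∑' n, c n * s ^ n) s) := by
  obtain ⟨r, hsr, hr⟩ := exists_between hs
  have hgeom := (summable_geometric_of_lt_one ((norm_nonneg s).trans hsr.le) hr).mul_left K
  refine (Complex.hasSum_deriv_of_summable_norm hgeom (fun n => by fun_prop) Metric.isOpen_ball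
    (fun n _ => norm_mul_pow_le_of_mem_ball hc n) (mem_ball_zero_iff.mpr hsr)).congr_fun fun n => ?_
  simp

/-- The coefficient of `s ^ n` in `₂F₁(-ν, ν + 1; 1; s)`. -/
noncomputable def legendreCoeff (ν : ℂ) (n : ℕ) : ℂ :=
  ordinaryHypergeometricCoefficient (-ν) (ν + 1) 1 n

@[simp] theorem legendreCoeff_zero (ν : ℂ) : legendreCoeff ν 0 = 1 := by
  simp [legendreCoeff, ordinaryHypergeometricCoefficient]

theorem legendreCoeff_succ (ν : ℂ) (n : ℕ) :
    ((n : ℂ) + 1) ^ 2 * legendreCoeff ν (n + 1) =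
      (n - ν) * (n + ν + 1) * legendreCoeff ν n := by
  have hn : (n : ℂ) + 1 ≠ 0 := Nat.cast_add_one_ne_zero n
  have hfac : (n.factorial : ℂ) ≠ 0 := Nat.cast_ne_zero.mpr n.factorial_ne_zero
  simp only [legendreCoeff, ordinaryHypergeometricCoefficient, ascPochhammer_succ_eval,
    ascPochhammer_eval_one, Nat.factorial_succ, add_comm (1 : ℂ) n]
  push_cast
  field_simp
  ring

theorem legendreCoeff_neg_sub_one (ν : ℂ) (n : ℕ) :
    legendreCoeff (-ν - 1) n = legendreCoeff ν n := by
  simp only [legendreCoeff, ordinaryHypergeometricCoefficient]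
  ring_nf

theorem differentiable_legendreCoeff (n : ℕ) : Differentiable ℂ fun ν => legendreCoeff ν n := by
  have := (ascPochhammer ℂ n).differentiable
  simp only [legendreCoeff, ordinaryHypergeometricCoefficient]
  fun_prop

theorem succ_mul_legendreCoeff_succ (ν : ℂ) (n : ℕ) :
    ((n : ℂ) + 1) * legendreCoeff ν (n + 1) =
      -ν * (1 + ν / (n + 1)) * ∏ j ∈ Finset.range n, (1 - ν ^ 2 / ((j : ℂ) + 1) ^ 2) := by
  have hn : (n : ℂ) + 1 ≠ 0 := Nat.cast_add_one_ne_zero n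
  induction n with
  | zero =>
    have h := legendreCoeff_succ ν 0
    simp only [Nat.cast_zero, zero_add, one_pow, one_mul, legendreCoeff_zero] at h
    simp only [Nat.cast_zero, zero_add, Finset.range_zero, Finset.prod_empty, h]
    ring
  | succ n ih =>
    have hn' : (n : ℂ) + 1 ≠ 0 := Nat.cast_add_one_ne_zero n
    have hstep := legendreCoeff_succ ν (n + 1)
    rw [Finset.prod_range_succ]
    push_cast at hstep hn ⊢
    have hratio : ((n : ℂ) + 1 + 1) * legendreCoeff ν (n + 1 + 1) =
        (n + 1 - ν) * (n + 1 + ν + 1) / ((n + 1 + 1) * (n + 1)) *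
          ((n + 1) * legendreCoeff ν (n + 1)) := by
      field_simp
      linear_combination hstep
    rw [hratio, ih hn']
    field_simp
    ring

theorem tendsto_mul_legendreCoeff (ν : ℂ) :
    Tendsto (fun n : ℕ => n * legendreCoeff ν n) atTop
      (𝓝 (-(Complex.sin (ν * Real.pi) / Real.pi))) := by
  rw [← tendsto_add_atTop_iff_nat 1]
  have hpi : (Real.pi : ℂ) ≠ 0 := Complex.ofReal_ne_zero.mpr Real.pi_ne_zero
  have hlim : Tendsto (fun n : ℕ => 1 + ν / ((n : ℂ) + 1)) atTop (𝓝 1) := by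
    simpa [div_eq_mul_inv] using
      ((tendsto_one_div_add_atTop_nhds_zero_nat (𝕜 := ℂ)).const_mul ν).const_add 1
  convert! ((Complex.tendsto_euler_sin_prod ν).mul hlim).mul_const (-(1 / (Real.pi : ℂ))) using 1
  · ext n
    push_cast
    rw [succ_mul_legendreCoeff_succ]
    field_simp
  · rw [mul_comm ν]
    congr 1
    ring

theorem norm_prod_one_sub_sq_div_sq_le {ν : ℂ} {R : ℝ} (hν : ‖ν‖ ≤ R) (n : ℕ) :
    ‖∏ j ∈ Finset.range n, (1 - ν ^ 2 / ((j : ℂ) + 1) ^ 2)‖ ≤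
      Real.exp (∑' j : ℕ, R ^ 2 / ((j : ℝ) + 1) ^ 2) := by
  have hsum : Summable fun j : ℕ => R ^ 2 / ((j : ℝ) + 1) ^ 2 := by
    simpa [div_eq_mul_inv] using ((summable_nat_add_iff 1).mpr
      (Real.summable_one_div_nat_pow.mpr one_lt_two)).mul_left (R ^ 2)
  have hfactor (j : ℕ) :
      ‖1 - ν ^ 2 / ((j : ℂ) + 1) ^ 2‖ ≤ Real.exp (R ^ 2 / ((j : ℝ) + 1) ^ 2) :=
    calc ‖1 - ν ^ 2 / ((j : ℂ) + 1) ^ 2‖ ≤ 1 + ‖ν‖ ^ 2 / ((j : ℝ) + 1) ^ 2 := by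
          refine (norm_sub_le _ _).trans_eq ?_
          rw [norm_one, norm_div, norm_pow, norm_pow, ← Nat.cast_add_one, Complex.norm_natCast,
            Nat.cast_add_one]
      _ ≤ R ^ 2 / ((j : ℝ) + 1) ^ 2 + 1 := by rw [add_comm]; gcongr
      _ ≤ _ := Real.add_one_le_exp _
  calc _ ≤ ∏ j ∈ Finset.range n, Real.exp (R ^ 2 / ((j : ℝ) + 1) ^ 2) := by
        rw [norm_prod]
        exact Finset.prod_le_prod (fun _ _ => norm_nonneg _) fun j _ => hfactor j
    _ = Real.exp (∑ j ∈ Finset.range n, R ^ 2 / ((j : ℝ) + 1) ^ 2) := (Real.exp_sum _ _).symm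
    _ ≤ _ := Real.exp_le_exp.mpr (hsum.sum_le_tsum _ fun j _ => by positivity)

theorem exists_norm_mul_legendreCoeff_le (R : ℝ) :
    ∃ K : ℝ, ∀ ν : ℂ, ‖ν‖ ≤ R → ∀ n : ℕ, ‖n * legendreCoeff ν n‖ ≤ K := by
  refine ⟨|R| * (1 + |R|) * Real.exp (∑' j : ℕ, |R| ^ 2 / ((j : ℝ) + 1) ^ 2), fun ν hν n => ?_⟩
  have hR : ‖ν‖ ≤ |R| := hν.trans (le_abs_self R)
  rcases n with _ | n
  · rw [Nat.cast_zero, zero_mul, norm_zero]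
    positivity
  have hfactor : ‖1 + ν / ((n : ℂ) + 1)‖ ≤ 1 + |R| :=
    calc ‖1 + ν / ((n : ℂ) + 1)‖ ≤ 1 + ‖ν‖ / ((n : ℝ) + 1) := by
          refine (norm_add_le _ _).trans_eq ?_
          rw [norm_one, norm_div, ← Nat.cast_add_one, Complex.norm_natCast, Nat.cast_add_one]
      _ ≤ 1 + |R| := by
          gcongr
          exact (div_le_self (norm_nonneg _) (by linarith [n.cast_nonneg (α := ℝ)])).trans hR
  rw [Nat.cast_add_one, succ_mul_legendreCoeff_succ, norm_mul, norm_mul, norm_neg]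
  gcongr
  exact norm_prod_one_sub_sq_div_sq_le hR n

theorem norm_legendreCoeff_le {ν : ℂ} {K : ℝ} (hK : ∀ n : ℕ, ‖n * legendreCoeff ν n‖ ≤ K)
    (n : ℕ) : ‖legendreCoeff ν n‖ ≤ 1 + K := by
  have hK0 : 0 ≤ K := (norm_nonneg _).trans (hK 0)
  rcases n with _ | n
  · simpa using hK0
  · have h := hK (n + 1)
    rw [norm_mul, Complex.norm_natCast] at h
    push_cast at h
    nlinarith [norm_nonneg (legendreCoeff ν (n + 1)), n.cast_nonneg (α := ℝ)]

/-- The Legendre function `P_ν` as an analytic function on the disc `‖1 - z‖ < 2`. -/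
noncomputable def complexLegendreP (ν z : ℂ) : ℂ :=
  ordinaryHypergeometric (-ν) (ν + 1) (1 : ℂ) ((1 - z) / 2)

/-- The flux `(1 - z²) P_ν'(z)`, in terms of which Legendre's equation is a first order system. -/
noncomputable def legendreFlux (ν z : ℂ) : ℂ := (1 - z ^ 2) * deriv (complexLegendreP ν) z

/-- The coefficient of `s ^ n` in `s (1 - s) f'(s)` for `f(s) = ₂F₁(-ν, ν + 1; 1; s)`. The truncated
subtraction is harmless at `n = 0`, where both terms vanish. -/
noncomputable def legendreFluxCoeff (ν : ℂ) (n : ℕ) : ℂ :=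
  n * legendreCoeff ν n - (n - 1 : ℕ) * legendreCoeff ν (n - 1)

theorem sum_range_legendreFluxCoeff (ν : ℂ) (n : ℕ) :
    ∑ i ∈ Finset.range (n + 1), legendreFluxCoeff ν i = n * legendreCoeff ν n := by
  induction n with
  | zero => simp [legendreFluxCoeff]
  | succ n ih =>
    rw [Finset.sum_range_succ, ih, legendreFluxCoeff, add_tsub_cancel_right]
    ring

theorem complexLegendreP_eq_tsum (ν z : ℂ) :
    complexLegendreP ν z = ∑' n, legendreCoeff ν n * ((1 - z) / 2) ^ n := by
  simp only [complexLegendreP, ordinaryHypergeometric_eq_tsum, smul_eq_mul, legendreCoeff,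
    ordinaryHypergeometricCoefficient]

theorem legendreP_neg_sub_one (ν : ℂ) : legendreP (-ν - 1) = legendreP ν := by
  ext x
  change complexLegendreP (-ν - 1) x = complexLegendreP ν x
  simp only [complexLegendreP_eq_tsum, legendreCoeff_neg_sub_one]

theorem norm_one_sub_div_two_lt_one {z : ℂ} (hz : z ∈ Metric.ball 1 2) : ‖(1 - z) / 2‖ < 1 := by
  rw [mem_ball_iff_norm'] at hz
  rw [norm_div, Complex.norm_ofNat]
  linarith

theorem exists_norm_legendreCoeff_le (ν : ℂ) : ∃ K : ℝ, ∀ n, ‖legendreCoeff ν n‖ ≤ K :=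
  let ⟨K, hK⟩ := exists_norm_mul_legendreCoeff_le ‖ν‖
  ⟨1 + K, norm_legendreCoeff_le (hK ν le_rfl)⟩

theorem hasDerivAt_one_sub_div_two (z : ℂ) : HasDerivAt (fun z : ℂ => (1 - z) / 2) (-1 / 2) z :=
  ((hasDerivAt_id z).const_sub 1).div_const 2

theorem hasDerivAt_complexLegendreP (ν : ℂ) {z : ℂ} (hz : z ∈ Metric.ball 1 2) :
    HasDerivAt (complexLegendreP ν)
      (deriv (fun s => ∑' n, legendreCoeff ν n * s ^ n) ((1 - z) / 2) * (-1 / 2)) z := by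
  obtain ⟨K, hK⟩ := exists_norm_legendreCoeff_le ν
  have hs := norm_one_sub_div_two_lt_one hz
  rw [funext (complexLegendreP_eq_tsum ν)]
  exact (differentiableAt_tsum_mul_pow hK hs).hasDerivAt.comp z (hasDerivAt_one_sub_div_two z)

theorem hasSum_one_sub_mul_deriv_complexLegendreP (ν : ℂ) {z : ℂ} (hz : z ∈ Metric.ball 1 2) :
    HasSum (fun n => n * legendreCoeff ν n * ((1 - z) / 2) ^ n)
      (-((1 - z) * deriv (complexLegendreP ν) z)) := by
  obtain ⟨K, hK⟩ := exists_norm_legendreCoeff_le ν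
  have hderiv := hasSum_deriv_tsum_mul_pow hK (norm_one_sub_div_two_lt_one hz)
  rw [(hasDerivAt_complexLegendreP ν hz).deriv]
  convert! hderiv.mul_left ((1 - z) / 2) using 1
  · ext n
    rcases n with _ | n
    · simp
    · rw [add_tsub_cancel_right, pow_succ]
      ring
  · ring

theorem hasSum_legendreFlux (ν : ℂ) {z : ℂ} (hz : z ∈ Metric.ball 1 2) :
    HasSum (fun n => -2 * legendreFluxCoeff ν n * ((1 - z) / 2) ^ n) (legendreFlux ν z) := by
  have hsum := hasSum_one_sub_mul_deriv_complexLegendreP ν hz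
  have hshift : HasSum (fun n => (n - 1 : ℕ) * legendreCoeff ν (n - 1) * ((1 - z) / 2) ^ n)
      ((1 - z) / 2 * -((1 - z) * deriv (complexLegendreP ν) z)) := by
    rw [← hasSum_nat_add_iff' 1]
    simpa [pow_succ, mul_comm, mul_assoc, mul_left_comm] using hsum.mul_left ((1 - z) / 2)
  convert! (hsum.sub hshift).mul_left (-2) using 1
  · ext n
    rw [legendreFluxCoeff]
    ring
  · rw [legendreFlux]
    ring

theorem hasDerivAt_legendreFlux (ν : ℂ) {z : ℂ} (hz : z ∈ Metric.ball 1 2) :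
    HasDerivAt (legendreFlux ν) (-(ν * (ν + 1)) * complexLegendreP ν z) z := by
  obtain ⟨K, hK⟩ := exists_norm_mul_legendreCoeff_le ‖ν‖
  have hs := norm_one_sub_div_two_lt_one hz
  have hcoeff (n : ℕ) : ‖-2 * legendreFluxCoeff ν n‖ ≤ 2 * (K + K) := by
    rw [norm_mul, norm_neg, Complex.norm_ofNat, legendreFluxCoeff]
    gcongr
    exact norm_sub_le_of_le (hK ν le_rfl n) (hK ν le_rfl (n - 1))
  have hderiv := (differentiableAt_tsum_mul_pow hcoeff hs).hasDerivAt.comp z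
    (hasDerivAt_one_sub_div_two z)
  have heq : legendreFlux ν =ᶠ[𝓝 z]
      (fun s => ∑' n, -2 * legendreFluxCoeff ν n * s ^ n) ∘ fun z => (1 - z) / 2 := by
    filter_upwards [Metric.isOpen_ball.mem_nhds hz] with y hy
    exact (hasSum_legendreFlux ν hy).tsum_eq.symm
  convert! hderiv.congr_of_eventuallyEq heq using 1
  have hflux := (hasSum_nat_add_iff' 1).mpr (hasSum_deriv_tsum_mul_pow hcoeff hs)
  have hP := (summable_mul_pow_of_norm_le (norm_legendreCoeff_le (hK ν le_rfl)) hs).hasSum.mul_left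
    (2 * (ν * (ν + 1)))
  rw [← complexLegendreP_eq_tsum] at hP
  have huniq := hflux.unique (hP.congr_fun fun n => ?_)
  · simp only [Finset.range_one, Finset.sum_singleton, Nat.cast_zero, zero_mul, mul_zero,
      sub_zero] at huniq
    rw [huniq]
    ring
  · simp only [legendreFluxCoeff, add_tsub_cancel_right]
    push_cast
    linear_combination -2 * ((1 - z) / 2) ^ n * legendreCoeff_succ ν n

theorem complexLegendreP_one (ν : ℂ) : complexLegendreP ν 1 = 1 := by
  simp [complexLegendreP]

theorem legendreFlux_one (ν : ℂ) : legendreFlux ν 1 = 0 := by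
  simp [legendreFlux]

theorem ofReal_mem_ball_one_two {x : ℝ} (hx : x ∈ Ioo (-1) 1) : (x : ℂ) ∈ Metric.ball 1 2 := by
  rw [mem_ball_iff_norm', ← Complex.ofReal_one, ← Complex.ofReal_sub, Complex.norm_real,
    Real.norm_of_nonneg (by linarith [hx.2])]
  linarith [hx.1]

theorem tendsto_legendreFlux_neg_one (ν : ℂ) :
    Tendsto (fun x : ℝ => legendreFlux ν x) (𝓝[>] (-1))
      (𝓝 (2 * Complex.sin (ν * Real.pi) / Real.pi)) := by
  have hpartial : Tendsto (fun n => ∑ i ∈ Finset.range n, -2 * legendreFluxCoeff ν i) atTop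
      (𝓝 (-2 * -(Complex.sin (ν * Real.pi) / Real.pi))) := by
    rw [← tendsto_add_atTop_iff_nat 1]
    simp_rw [← Finset.mul_sum, sum_range_legendreFluxCoeff]
    exact (tendsto_mul_legendreCoeff ν).const_mul _
  have hparam : Tendsto (fun x : ℝ => (1 - x) / 2) (𝓝[>] (-1)) (𝓝[<] 1) := by
    refine tendsto_nhdsWithin_iff.mpr ⟨?_, ?_⟩
    · exact (Continuous.tendsto' (by fun_prop) _ _ (by norm_num)).mono_left nhdsWithin_le_nhds
    · filter_upwards [self_mem_nhdsWithin] with x hx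
      rw [mem_Ioi] at hx
      rw [mem_Iio]
      linarith
  have habel := (tendsto_map'_iff.mp (Complex.tendsto_tsum_powerSeries_nhdsWithin_lt hpartial)).comp
    hparam
  rw [show 2 * Complex.sin (ν * Real.pi) / Real.pi =
    -2 * -(Complex.sin (ν * Real.pi) / Real.pi) by ring]
  refine habel.congr' ?_
  filter_upwards [Ioo_mem_nhdsGT (show (-1 : ℝ) < 1 by norm_num)] with x hx
  rw [← (hasSum_legendreFlux ν (ofReal_mem_ball_one_two hx)).tsum_eq]
  simp

theorem norm_mul_ofReal_pow_succ_le {c : ℂ} {K t : ℝ} (hc : ‖c‖ ≤ K) (ht : 0 ≤ t) (n : ℕ) :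
    ‖c * (t : ℂ) ^ (n + 1)‖ ≤ K * t ^ (n + 1) := by
  rw [norm_mul, norm_pow, Complex.norm_real, Real.norm_of_nonneg ht]
  gcongr

theorem norm_legendreFlux_le {ν : ℂ} {K : ℝ} (hK : ∀ n : ℕ, ‖n * legendreCoeff ν n‖ ≤ K) {x : ℝ}
    (hx : x ∈ Ioo (-1) 1) : ‖legendreFlux ν x‖ ≤ K * (1 - x) := by
  obtain ⟨t, ht⟩ : ∃ t : ℝ, t = (1 - x) / 2 := ⟨_, rfl⟩
  have htx : (1 - (x : ℂ)) / 2 = t := by rw [ht]; push_cast; rfl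
  have ht0 : 0 ≤ t := by linarith [hx.2]
  have ht1 : 0 < 1 - t := by linarith [hx.1]
  have hgeom := (hasSum_geometric_of_lt_one ht0 (by linarith)).mul_left (K * t)
  have hsum := (hasSum_nat_add_iff' 1).mpr
    (hasSum_one_sub_mul_deriv_complexLegendreP ν (ofReal_mem_ball_one_two hx))
  rw [htx] at hsum
  simp only [Finset.range_one, Finset.sum_singleton, Nat.cast_zero, zero_mul, sub_zero] at hsum
  have hbound : ‖(1 - (x : ℂ)) * deriv (complexLegendreP ν) x‖ ≤ K * t * (1 - t)⁻¹ := by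
    rw [← norm_neg]
    refine hsum.norm_le_of_bounded hgeom fun n => ?_
    refine (norm_mul_ofReal_pow_succ_le (hK (n + 1)) ht0 n).trans_eq ?_
    ring
  have hnorm : ‖1 + (x : ℂ)‖ = 2 * (1 - t) := by
    rw [← Complex.ofReal_one, ← Complex.ofReal_add, Complex.norm_real,
      Real.norm_of_nonneg (by linarith)]
    linarith
  calc ‖legendreFlux ν x‖ = ‖1 + (x : ℂ)‖ * ‖(1 - (x : ℂ)) * deriv (complexLegendreP ν) x‖ := by
        rw [← norm_mul, legendreFlux]
        ring_nf
    _ ≤ 2 * (1 - t) * (K * t * (1 - t)⁻¹) := by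
        rw [hnorm]
        gcongr
    _ = K * (1 - x) := by
        field_simp
        rw [ht]
        ring

theorem norm_complexLegendreP_sub_one_le {ν : ℂ} {K : ℝ}
    (hK : ∀ n : ℕ, ‖n * legendreCoeff ν n‖ ≤ K) {x : ℝ} (hx : x ∈ Ioo (-1) 1) :
    ‖complexLegendreP ν x - 1‖ ≤ K * -Real.log ((1 + x) / 2) := by
  obtain ⟨t, ht⟩ : ∃ t : ℝ, t = (1 - x) / 2 := ⟨_, rfl⟩
  have htx : (1 - (x : ℂ)) / 2 = t := by rw [ht]; push_cast; rfl
  have hsplit : (1 + x) / 2 = 1 - t := by linarith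
  have ht0 : 0 ≤ t := by linarith [hx.2]
  have ht1 : t < 1 := by linarith [hx.1]
  have hsum : HasSum _ (complexLegendreP ν x) :=
    complexLegendreP_eq_tsum ν x ▸ (summable_mul_pow_of_norm_le (norm_legendreCoeff_le hK)
      (norm_one_sub_div_two_lt_one (ofReal_mem_ball_one_two hx))).hasSum
  have htail := (hasSum_nat_add_iff' 1).mpr hsum
  rw [htx] at htail
  simp only [Finset.range_one, Finset.sum_singleton, legendreCoeff_zero, pow_zero, mul_one] at htail
  have hlog := (Real.hasSum_pow_div_log_of_abs_lt_one (abs_lt.mpr ⟨by linarith, ht1⟩)).mul_left K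
  rw [hsplit]
  refine htail.norm_le_of_bounded hlog fun n => ?_
  have hcoeff : ‖legendreCoeff ν (n + 1)‖ ≤ K / (n + 1) := by
    have h := hK (n + 1)
    rw [norm_mul, Complex.norm_natCast, Nat.cast_add_one] at h
    rwa [le_div_iff₀' (by positivity)]
  refine (norm_mul_ofReal_pow_succ_le hcoeff ht0 n).trans_eq ?_
  ring

theorem neg_log_le_two_div_sqrt {t : ℝ} (ht : 0 ≤ t) : -Real.log t ≤ 2 / √t := by
  have h := Real.log_le_self (inv_nonneg.mpr (Real.sqrt_nonneg t))
  rw [Real.log_inv, Real.log_sqrt ht] at h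
  rw [div_eq_mul_inv]
  linarith

theorem norm_complexLegendreP_le {ν : ℂ} {K : ℝ} (hK : ∀ n : ℕ, ‖n * legendreCoeff ν n‖ ≤ K)
    {x : ℝ} (hx : x ∈ Ioo (-1) 1) :
    ‖complexLegendreP ν x‖ ≤ (1 + 2 * K) / √((1 + x) / 2) := by
  have hK0 : 0 ≤ K := (norm_nonneg _).trans (hK 0)
  have hpos : 0 < (1 + x) / 2 := by linarith [hx.1]
  have hone : 1 ≤ 1 / √((1 + x) / 2) :=
    one_le_one_div (Real.sqrt_pos.mpr hpos) (Real.sqrt_le_one.mpr (by linarith [hx.2]))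
  calc ‖complexLegendreP ν x‖ ≤ 1 + ‖complexLegendreP ν x - 1‖ := by
        simpa using norm_add_le 1 (complexLegendreP ν x - 1)
    _ ≤ 1 / √((1 + x) / 2) + K * (2 / √((1 + x) / 2)) := by
        gcongr
        exact (norm_complexLegendreP_sub_one_le hK hx).trans
          (by gcongr; exact neg_log_le_two_div_sqrt hpos.le)
    _ = (1 + 2 * K) / √((1 + x) / 2) := by ring

section SturmLiouville

variable {𝕜 : Type*} [NontriviallyNormedField 𝕜] {p : 𝕜 → 𝕜} {lam : 𝕜} {z : 𝕜}
  {u U v V G H K : 𝕜 → 𝕜}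

/-- The equation `(p u')' + lam u = 0` at the point `z`, written as a first order system for `u` and
its flux `U = p u'`. -/
structure SturmLiouvilleAt (p : 𝕜 → 𝕜) (lam : 𝕜) (u U : 𝕜 → 𝕜) (z : 𝕜) : Prop where
  hasDerivAt : HasDerivAt u (U z / p z) z
  hasDerivAt_flux : HasDerivAt U (-lam * u z) z

/-- The symmetric square of the system `SturmLiouvilleAt` at the point `z`: the system satisfied by
`G = u v`, `H = u V + U v` and `K = U V` for any two of its solutions `(u, U)` and `(v, V)`. -/
structure SymSquareAt (p : 𝕜 → 𝕜) (lam : 𝕜) (G H K : 𝕜 → 𝕜) (z : 𝕜) : Prop where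
  hasDerivAt : HasDerivAt G (H z / p z) z
  hasDerivAt_flux : HasDerivAt H (-2 * lam * G z + 2 * K z / p z) z
  hasDerivAt_sq_flux : HasDerivAt K (-lam * H z) z

/-- The pairing of a triple `(G, H, K)` with two pairs `(u, U)` and `(v, V)` that is constant along
solutions of `SymSquareAt` and `SturmLiouvilleAt`. -/
def symSquarePairing (G H K u U v V : 𝕜 → 𝕜) (z : 𝕜) : 𝕜 :=
  2 * (U z * V z) * G z - (u z * V z + U z * v z) * H z + 2 * (u z * v z) * K z

theorem SturmLiouvilleAt.comp_neg (hp : Function.Even p) (hu : SturmLiouvilleAt p lam u U (-z)) :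
    SturmLiouvilleAt p lam (fun z => u (-z)) (fun z => -U (-z)) z where
  hasDerivAt := by
    convert! hu.hasDerivAt.comp z (hasDerivAt_neg z) using 1
    rw [hp z]
    ring
  hasDerivAt_flux := by
    convert! (hu.hasDerivAt_flux.comp z (hasDerivAt_neg z)).neg using 1
    ring

theorem symSquarePairing_comp_neg (hG : Function.Odd G) (hH : Function.Even H)
    (hK : Function.Odd K) (z : 𝕜) :
    symSquarePairing G H K (fun z => u (-z)) (fun z => -U (-z)) (fun z => v (-z))
      (fun z => -V (-z)) z = -symSquarePairing G H K u U v V (-z) := by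
  simp only [symSquarePairing, hG z, hH z, hK z]
  ring

theorem SturmLiouvilleAt.mul (hu : SturmLiouvilleAt p lam u U z)
    (hv : SturmLiouvilleAt p lam v V z) :
    SymSquareAt p lam (fun z => u z * v z) (fun z => u z * V z + U z * v z)
      (fun z => U z * V z) z where
  hasDerivAt := by
    convert! hu.hasDerivAt.mul hv.hasDerivAt using 1
    ring
  hasDerivAt_flux := by
    convert! (hu.hasDerivAt.mul hv.hasDerivAt_flux).add (hu.hasDerivAt_flux.mul hv.hasDerivAt)
      using 1
    ring
  hasDerivAt_sq_flux := by
    convert! hu.hasDerivAt_flux.mul hv.hasDerivAt_flux using 1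
    ring

theorem SturmLiouvilleAt.hasDerivAt_wronskian (hu : SturmLiouvilleAt p lam u U z)
    (hv : SturmLiouvilleAt p lam v V z) :
    HasDerivAt (fun z => u z * V z - U z * v z) 0 z := by
  convert! (hu.hasDerivAt.mul hv.hasDerivAt_flux).sub (hu.hasDerivAt_flux.mul hv.hasDerivAt) using 1
  ring

theorem SymSquareAt.hasDerivAt_symSquarePairing (hG : SymSquareAt p lam G H K z)
    (hu : SturmLiouvilleAt p lam u U z) (hv : SturmLiouvilleAt p lam v V z) :
    HasDerivAt (symSquarePairing G H K u U v V) 0 z := by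
  have huv := hu.mul hv
  convert! (((huv.hasDerivAt_sq_flux.const_mul 2).mul hG.hasDerivAt).sub
    (huv.hasDerivAt_flux.mul hG.hasDerivAt_flux)).add
    ((huv.hasDerivAt.const_mul 2).mul hG.hasDerivAt_sq_flux) using 1
  ring

theorem two_mul_wronskian_sq_mul (G H K u U v V : 𝕜 → 𝕜) (z : 𝕜) :
    2 * (u z * V z - U z * v z) ^ 2 * G z =
      u z ^ 2 * symSquarePairing G H K v V v V z + v z ^ 2 * symSquarePairing G H K u U u U z -
        2 * (u z * v z) * symSquarePairing G H K u U v V z := by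
  simp only [symSquarePairing]
  ring

theorem eq_of_forall_hasDerivAt_zero {𝕜 F : Type*} [RCLike 𝕜] [NormedAddCommGroup F]
    [NormedSpace 𝕜 F] {f : 𝕜 → F} {s : Set 𝕜} (hopen : IsOpen s) (hconn : IsPreconnected s)
    (hf : ∀ z ∈ s, HasDerivAt f 0 z) {y z : 𝕜} (hy : y ∈ s) (hz : z ∈ s) : f y = f z :=
  hopen.is_const_of_deriv_eq_zero hconn
    (fun z hz => (hf z hz).differentiableAt.differentiableWithinAt) (fun z hz => (hf z hz).deriv)
    hy hz

end SturmLiouville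

section CauchyTransform

variable {a b : ℝ} {g w w' : ℝ → ℂ} {z : ℂ}

/-- The Cauchy transform `∫ g(ξ) / (z - ξ) dξ` over `[a, b]`, which is holomorphic in `z` off the
segment `[a, b]`. -/
noncomputable def cauchyTransform (a b : ℝ) (g : ℝ → ℂ) (z : ℂ) : ℂ :=
  ∫ ξ in a..b, g ξ / (z - ξ)

theorem isOpen_compl_ofReal_image_uIcc : IsOpen (Complex.ofReal '' [[a, b]])ᶜ :=
  (isCompact_uIcc.image Complex.continuous_ofReal).isClosed.isOpen_compl

theorem exists_pos_forall_le_norm_sub_ofReal (hz : z ∉ Complex.ofReal '' [[a, b]]) :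
    ∃ δ > 0, ∀ y ∈ Metric.ball z δ, ∀ ξ ∈ [[a, b]], δ ≤ ‖y - (ξ : ℂ)‖ := by
  obtain ⟨ε, hε, hball⟩ := Metric.isOpen_iff.mp isOpen_compl_ofReal_image_uIcc z hz
  refine ⟨ε / 2, half_pos hε, fun y hy ξ hξ => ?_⟩
  by_contra! hlt
  refine hball (?_ : (ξ : ℂ) ∈ Metric.ball z ε) (mem_image_of_mem _ hξ)
  rw [Metric.mem_ball] at hy ⊢
  rw [← dist_eq_norm, dist_comm] at hlt
  linarith [dist_triangle (ξ : ℂ) y z]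

theorem sub_ofReal_ne_zero (hz : z ∉ Complex.ofReal '' [[a, b]]) {ξ : ℝ} (hξ : ξ ∈ [[a, b]]) :
    z - ξ ≠ 0 :=
  sub_ne_zero.mpr fun h => hz ⟨ξ, hξ, h.symm⟩

theorem intervalIntegrable_div_sub_pow (hg : IntervalIntegrable g volume a b)
    (hz : z ∉ Complex.ofReal '' [[a, b]]) (n : ℕ) :
    IntervalIntegrable (fun ξ => g ξ / (z - ξ) ^ n) volume a b := by
  simp only [div_eq_mul_inv]
  exact hg.mul_continuousOn (ContinuousOn.inv₀ (by fun_prop)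
    fun ξ hξ => pow_ne_zero n (sub_ofReal_ne_zero hz hξ))

theorem intervalIntegrable_div_sub (hg : IntervalIntegrable g volume a b)
    (hz : z ∉ Complex.ofReal '' [[a, b]]) :
    IntervalIntegrable (fun ξ => g ξ / (z - ξ)) volume a b := by
  simpa using intervalIntegrable_div_sub_pow hg hz 1

theorem hasDerivAt_cauchyTransform (hg : IntervalIntegrable g volume a b)
    (hz : z ∉ Complex.ofReal '' [[a, b]]) :
    HasDerivAt (cauchyTransform a b g) (-∫ ξ in a..b, g ξ / (z - ξ) ^ 2) z := by
  obtain ⟨δ, hδ, hdist⟩ := exists_pos_forall_le_norm_sub_ofReal hz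
  have hoff {y : ℂ} (hy : y ∈ Metric.ball z δ) : y ∉ Complex.ofReal '' [[a, b]] := by
    rintro ⟨ξ, hξ, rfl⟩
    simpa using hδ.trans_le (hdist _ hy ξ hξ)
  rw [← intervalIntegral.integral_neg]
  refine (intervalIntegral.hasDerivAt_integral_of_dominated_loc_of_deriv_le
    (F' := fun y ξ => -(g ξ / (y - ξ) ^ 2)) (bound := fun ξ => ‖g ξ‖ / δ ^ 2)
    (Metric.ball_mem_nhds z hδ) ?_ (intervalIntegrable_div_sub hg hz) ?_ ?_
    (hg.norm.div_const _) ?_).2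
  · filter_upwards [Metric.ball_mem_nhds z hδ] with y hy
    exact (intervalIntegrable_div_sub hg (hoff hy)).aestronglyMeasurable_restrict_uIoc
  · exact (intervalIntegrable_div_sub_pow hg hz 2).neg.aestronglyMeasurable_restrict_uIoc
  · refine .of_forall fun ξ hξ y hy => ?_
    rw [norm_neg, norm_div, norm_pow]
    gcongr
    exact hdist y hy ξ (uIoc_subset_uIcc hξ)
  · refine .of_forall fun ξ hξ y hy => ?_
    convert! (((hasDerivAt_id y).sub_const (ξ : ℂ)).inv
      (sub_ofReal_ne_zero (hoff hy) (uIoc_subset_uIcc hξ))).const_mul (g ξ) using 1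
    rw [id]
    ring

theorem hasDerivAt_cauchyTransform_of_tendsto_zero (hab : a < b)
    (hw : IntervalIntegrable w volume a b) (hderiv : ∀ ξ ∈ Ioo a b, HasDerivAt w (w' ξ) ξ)
    (hw' : IntervalIntegrable w' volume a b) (hlim : Tendsto w (𝓝[>] a ⊔ 𝓝[<] b) (𝓝 0))
    (hz : z ∉ Complex.ofReal '' [[a, b]]) :
    HasDerivAt (cauchyTransform a b w) (cauchyTransform a b w' z) z := by
  have hparts (ξ) (hξ : ξ ∈ Ioo a b) : HasDerivAt (fun ξ : ℝ => w ξ / (z - ξ))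
      (w' ξ / (z - ξ) + w ξ / (z - ξ) ^ 2) ξ := by
    have hne := sub_ofReal_ne_zero hz (Icc_subset_uIcc (Ioo_subset_Icc_self hξ))
    convert! (hderiv ξ hξ).div ((hasDerivAt_id (ξ : ℂ)).comp_ofReal.const_sub z) hne using 1
    simp only [id]
    field_simp
    ring
  have hdiv {c : ℝ} {l : Filter ℝ} (hl : l ≤ 𝓝 c) (hc : c ∈ [[a, b]]) (hwl : Tendsto w l (𝓝 0)) :
      Tendsto (fun ξ : ℝ => w ξ / (z - ξ)) l (𝓝 0) := by
    have hcont : Tendsto (fun ξ : ℝ => z - ξ) l (𝓝 (z - c)) :=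
      (Continuous.tendsto (by fun_prop) c).mono_left hl
    exact zero_div (z - (c : ℂ)) ▸ hwl.div hcont (sub_ofReal_ne_zero hz hc)
  have hint := intervalIntegrable_div_sub hw' hz
  have hint2 := intervalIntegrable_div_sub_pow hw hz 2
  have hFTC := intervalIntegral.integral_eq_sub_of_hasDerivAt_of_tendsto hab hparts
    (hint.add hint2)
    (hdiv nhdsWithin_le_nhds left_mem_uIcc (hlim.mono_left le_sup_left))
    (hdiv nhdsWithin_le_nhds right_mem_uIcc (hlim.mono_left le_sup_right))
  rw [intervalIntegral.integral_add hint hint2, sub_zero, add_eq_zero_iff_eq_neg] at hFTC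
  rw [cauchyTransform, hFTC]
  exact hasDerivAt_cauchyTransform hw hz

theorem cauchyTransform_add {g₁ g₂ : ℝ → ℂ} (h₁ : IntervalIntegrable g₁ volume a b)
    (h₂ : IntervalIntegrable g₂ volume a b) (hz : z ∉ Complex.ofReal '' [[a, b]]) :
    cauchyTransform a b (fun ξ => g₁ ξ + g₂ ξ) z =
      cauchyTransform a b g₁ z + cauchyTransform a b g₂ z := by
  simp only [cauchyTransform, add_div]
  exact intervalIntegral.integral_add (intervalIntegrable_div_sub h₁ hz)
    (intervalIntegrable_div_sub h₂ hz)

theorem cauchyTransform_const_mul (c : ℂ) (g : ℝ → ℂ) (z : ℂ) :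
    cauchyTransform a b (fun ξ => c * g ξ) z = c * cauchyTransform a b g z := by
  simp only [cauchyTransform, mul_div_assoc]
  exact intervalIntegral.integral_const_mul c _

theorem intervalIntegrable_ofReal_mul (hg : IntervalIntegrable g volume a b) :
    IntervalIntegrable (fun ξ => ξ * g ξ) volume a b :=
  hg.continuousOn_mul Complex.continuous_ofReal.continuousOn

theorem cauchyTransform_ofReal_mul (hg : IntervalIntegrable g volume a b)
    (hz : z ∉ Complex.ofReal '' [[a, b]]) :
    cauchyTransform a b (fun ξ => ξ * g ξ) z =
      z * cauchyTransform a b g z - ∫ ξ in a..b, g ξ := by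
  simp only [cauchyTransform]
  rw [← intervalIntegral.integral_const_mul, ← intervalIntegral.integral_sub
    ((intervalIntegrable_div_sub hg hz).const_mul z) hg]
  refine intervalIntegral.integral_congr fun ξ hξ => ?_
  have hne := sub_ofReal_ne_zero hz hξ
  field_simp
  ring

theorem cauchyTransform_quadratic_mul (hg : IntervalIntegrable g volume a b) (α β γ : ℂ)
    (hz : z ∉ Complex.ofReal '' [[a, b]]) :
    cauchyTransform a b (fun ξ => (α + β * ξ + γ * ξ ^ 2) * g ξ) z =
      (α + β * z + γ * z ^ 2) * cauchyTransform a b g z -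
        (β * (∫ ξ in a..b, g ξ) + γ * (z * (∫ ξ in a..b, g ξ) + ∫ ξ in a..b, ξ * g ξ)) := by
  have hg₁ := intervalIntegrable_ofReal_mul hg
  have hg₂ := intervalIntegrable_ofReal_mul hg₁
  rw [show (fun ξ : ℝ => (α + β * ξ + γ * ξ ^ 2) * g ξ) =
      fun ξ : ℝ => α * g ξ + β * (ξ * g ξ) + γ * (ξ * (ξ * g ξ)) by ext; ring,
    cauchyTransform_add ((hg.const_mul α).add (hg₁.const_mul β)) (hg₂.const_mul γ) hz,
    cauchyTransform_add (hg.const_mul α) (hg₁.const_mul β) hz, cauchyTransform_const_mul,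
    cauchyTransform_const_mul, cauchyTransform_const_mul, cauchyTransform_ofReal_mul hg₁ hz,
    cauchyTransform_ofReal_mul hg hz]
  ring

section Quadratic

variable {p : ℂ → ℂ} {α β γ lam : ℂ}

theorem hasDerivAt_cauchyTransform_of_quadratic_mul_tendsto_zero
    (hp : ∀ z, p z = α + β * z + γ * z ^ 2) (hab : a < b) {h : ℝ → ℂ}
    (hp0 : ∀ ξ ∈ Ioo a b, p ξ ≠ 0) (hderiv : ∀ ξ ∈ Ioo a b, HasDerivAt w (h ξ / p ξ) ξ)
    (hw : IntervalIntegrable w volume a b) (hh : IntervalIntegrable h volume a b)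
    (hlim : Tendsto (fun ξ : ℝ => p ξ * w ξ) (𝓝[>] a ⊔ 𝓝[<] b) (𝓝 0))
    (hz : z ∉ Complex.ofReal '' [[a, b]]) (hpz : p z ≠ 0) :
    HasDerivAt (cauchyTransform a b w)
      ((cauchyTransform a b h z - γ * ∫ ξ in a..b, w ξ) / p z) z := by
  have hp' (z : ℂ) : HasDerivAt p (β + γ * (2 * z)) z := by
    rw [funext hp]
    convert! (((hasDerivAt_id z).const_mul β).const_add α).add ((hasDerivAt_pow 2 z).const_mul γ)
      using 1
    simp
  have hpw : IntervalIntegrable (fun ξ : ℝ => p ξ * w ξ) volume a b :=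
    hw.continuousOn_mul (by simp only [hp]; fun_prop)
  have hp'w : IntervalIntegrable (fun ξ : ℝ => (β + 2 * γ * ξ + 0 * ξ ^ 2) * w ξ) volume a b :=
    hw.continuousOn_mul (by fun_prop)
  have hderiv_mul (ξ) (hξ : ξ ∈ Ioo a b) : HasDerivAt (fun ξ : ℝ => p ξ * w ξ)
      ((β + 2 * γ * ξ + 0 * ξ ^ 2) * w ξ + h ξ) ξ := by
    convert! (hp' ξ).comp_ofReal.mul (hderiv ξ hξ) using 1
    have := hp0 ξ hξ
    field_simp
    ring
  have hleft := hasDerivAt_cauchyTransform_of_tendsto_zero hab hpw hderiv_mul (hp'w.add hh) hlim hz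
  have hC := hasDerivAt_cauchyTransform hw hz
  have hright := ((hp' z).mul hC).sub
    (((hasDerivAt_id z).mul_const (∫ ξ in a..b, w ξ)).add_const (∫ ξ in a..b, ξ * w ξ) |>.const_mul
      γ |>.const_add (β * ∫ ξ in a..b, w ξ))
  have heq : cauchyTransform a b (fun ξ => p ξ * w ξ) =ᶠ[𝓝 z] fun y => p y * cauchyTransform a b w y
      - (β * (∫ ξ in a..b, w ξ) + γ * (y * (∫ ξ in a..b, w ξ) + ∫ ξ in a..b, ξ * w ξ)) := by
    filter_upwards [isOpen_compl_ofReal_image_uIcc.mem_nhds hz] with y hy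
    simpa only [hp] using cauchyTransform_quadratic_mul hw α β γ hy
  have huniq := hleft.unique (hright.congr_of_eventuallyEq heq)
  rw [cauchyTransform_add hp'w hh hz, cauchyTransform_quadratic_mul hw _ _ _ hz] at huniq
  convert! hC using 1
  rw [div_eq_iff hpz]
  linear_combination huniq

/-- The commutator of the Cauchy transform with multiplication by a quadratic polynomial has finite
rank, which is absorbed by correction terms that are constant in the second component and affine in
the third. -/
theorem symSquareAt_cauchyTransform (hp : ∀ z, p z = α + β * z + γ * z ^ 2) (hab : a < b)
    {w h k : ℂ → ℂ} (hp0 : ∀ ξ ∈ Ioo a b, p (ξ : ℝ) ≠ 0)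
    (hsys : ∀ ξ ∈ Ioo a b, SymSquareAt p lam w h k (ξ : ℝ))
    (hw : IntervalIntegrable (fun ξ : ℝ => w ξ) volume a b)
    (hh : IntervalIntegrable (fun ξ : ℝ => h ξ) volume a b)
    (hk : IntervalIntegrable (fun ξ : ℝ => k ξ) volume a b)
    (hw0 : Tendsto (fun ξ : ℝ => p ξ * w ξ) (𝓝[>] a ⊔ 𝓝[<] b) (𝓝 0))
    (hh0 : Tendsto (fun ξ : ℝ => p ξ * h ξ) (𝓝[>] a ⊔ 𝓝[<] b) (𝓝 0))
    (hk0 : Tendsto (fun ξ : ℝ => k ξ) (𝓝[>] a ⊔ 𝓝[<] b) (𝓝 0))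
    (hz : z ∉ Complex.ofReal '' [[a, b]]) (hpz : p z ≠ 0) :
    SymSquareAt p lam (cauchyTransform a b fun ξ => w ξ)
      (fun z => cauchyTransform a b (fun ξ => h ξ) z - γ * ∫ ξ in a..b, w ξ)
      (fun z => cauchyTransform a b (fun ξ => k ξ) z - γ / 2 * (∫ ξ in a..b, h ξ) +
        lam * (β * (∫ ξ in a..b, w ξ) + γ * (z * (∫ ξ in a..b, w ξ) + ∫ ξ in a..b, ξ * w ξ)))
      z where
  hasDerivAt := hasDerivAt_cauchyTransform_of_quadratic_mul_tendsto_zero hp hab hp0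
    (fun ξ hξ => (hsys ξ hξ).hasDerivAt.comp_ofReal) hw hh hw0 hz hpz
  hasDerivAt_flux := by
    have hpw : IntervalIntegrable (fun ξ : ℝ => p ξ * w ξ) volume a b :=
      hw.continuousOn_mul (by simp only [hp]; fun_prop)
    have hderiv (ξ) (hξ : ξ ∈ Ioo a b) : HasDerivAt (fun ξ : ℝ => h ξ)
        ((-2 * lam * (p ξ * w ξ) + 2 * k ξ) / p ξ) ξ := by
      convert! (hsys ξ hξ).hasDerivAt_flux.comp_ofReal using 1
      have := hp0 ξ hξ
      field_simp
    convert! (hasDerivAt_cauchyTransform_of_quadratic_mul_tendsto_zero hp hab hp0 hderiv hh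
      ((hpw.const_mul _).add (hk.const_mul 2)) hh0 hz hpz).sub_const (γ * ∫ ξ in a..b, w ξ) using 1
    rw [cauchyTransform_add (hpw.const_mul _) (hk.const_mul 2) hz, cauchyTransform_const_mul,
      cauchyTransform_const_mul]
    simp only [hp] at hpz ⊢
    rw [cauchyTransform_quadratic_mul hw _ _ _ hz]
    field_simp
    ring
  hasDerivAt_sq_flux := by
    have hCk := hasDerivAt_cauchyTransform_of_tendsto_zero hab hk
      (fun ξ hξ => (hsys ξ hξ).hasDerivAt_sq_flux.comp_ofReal) (hh.const_mul _) hk0 hz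
    rw [cauchyTransform_const_mul] at hCk
    convert! (hCk.sub_const (γ / 2 * ∫ ξ in a..b, h ξ)).add
      (((hasDerivAt_id z).mul_const (∫ ξ in a..b, w ξ)).add_const (∫ ξ in a..b, ξ * w ξ)
        |>.const_mul γ |>.const_add (β * ∫ ξ in a..b, w ξ) |>.const_mul lam) using 1
    ring

end Quadratic

theorem cauchyTransform_neg (a b : ℝ) (g : ℝ → ℂ) (z : ℂ) :
    cauchyTransform a b g (-z) = -cauchyTransform (-b) (-a) (fun ξ => g (-ξ)) z := by
  simp only [cauchyTransform]
  rw [← intervalIntegral.integral_comp_neg, ← intervalIntegral.integral_neg]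
  refine intervalIntegral.integral_congr fun ξ _ => ?_
  simp only [neg_neg]
  push_cast
  rw [← div_neg]
  ring_nf

theorem odd_cauchyTransform_of_even (hg : Function.Even g) :
    Function.Odd (cauchyTransform (-a) a g) := fun z => by
  rw [cauchyTransform_neg, neg_neg, funext hg]

theorem even_cauchyTransform_of_odd (hg : Function.Odd g) :
    Function.Even (cauchyTransform (-a) a g) := fun z => by
  rw [cauchyTransform_neg, neg_neg, funext hg]
  simp [cauchyTransform, neg_div]

theorem intervalIntegral_eq_zero_of_odd (hg : Function.Odd g) : ∫ ξ in -a..a, g ξ = 0 := by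
  have h := intervalIntegral.integral_comp_neg (a := -a) (b := a) g
  rw [neg_neg, funext hg, intervalIntegral.integral_neg] at h
  exact self_eq_neg.mp h.symm

theorem notMem_ofReal_image_uIcc_of_lt (hab : a ≤ b) {y : ℝ} (hy : b < y) :
    (y : ℂ) ∉ Complex.ofReal '' [[a, b]] := by
  rw [uIcc_of_le hab, Complex.ofReal_injective.mem_set_image]
  exact fun h => hy.not_ge h.2

theorem tendsto_sub_mul_cauchyTransform (hab : a ≤ b) (hg : IntervalIntegrable g volume a b) :
    Tendsto (fun y : ℝ => ((y : ℂ) - b) * cauchyTransform a b g y) (𝓝[>] b) (𝓝 0) := by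
  simp only [cauchyTransform, ← intervalIntegral.integral_const_mul]
  rw [← intervalIntegral.integral_zero (μ := volume) (a := a) (b := b)]
  refine intervalIntegral.tendsto_integral_filter_of_dominated_convergence (fun ξ => ‖g ξ‖) ?_ ?_
    hg.norm ?_
  · filter_upwards [self_mem_nhdsWithin] with y hy
    exact ((intervalIntegrable_div_sub hg
      (notMem_ofReal_image_uIcc_of_lt hab hy)).const_mul _).aestronglyMeasurable_restrict_uIoc
  · filter_upwards [self_mem_nhdsWithin] with y hy
    rw [mem_Ioi] at hy
    refine .of_forall fun ξ hξ => ?_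
    rw [uIoc_of_le hab] at hξ
    rw [← Complex.ofReal_sub, ← Complex.ofReal_sub, norm_mul, norm_div, Complex.norm_real,
      Complex.norm_real, Real.norm_of_nonneg (by linarith),
      Real.norm_of_nonneg (by linarith [hξ.2]), mul_div_left_comm]
    refine mul_le_of_le_one_right (norm_nonneg _) (div_le_one_of_le₀ ?_ ?_) <;> linarith [hξ.2]
  · filter_upwards [compl_mem_ae_iff.mpr (measure_singleton b)] with ξ hξb _
    have hne : (b : ℂ) - ξ ≠ 0 := by
      rw [← Complex.ofReal_sub, Complex.ofReal_ne_zero, sub_ne_zero]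
      exact Ne.symm hξb
    have hcont : ContinuousAt (fun y : ℝ => ((y : ℂ) - b) * (g ξ / (y - ξ))) b := by fun_prop
    simpa using hcont.tendsto.mono_left nhdsWithin_le_nhds

theorem tendsto_cauchyTransform_sub_mul (hab : a ≤ b) (hg : IntervalIntegrable g volume a b) :
    Tendsto (fun y : ℝ => cauchyTransform a b (fun ξ => ((b : ℂ) - ξ) * g ξ) y) (𝓝[>] b)
      (𝓝 (∫ ξ in a..b, g ξ)) := by
  have hlim := (tendsto_sub_mul_cauchyTransform hab hg).const_sub (∫ ξ in a..b, g ξ)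
  rw [sub_zero] at hlim
  refine hlim.congr' ?_
  filter_upwards [self_mem_nhdsWithin] with y hy
  have h := cauchyTransform_quadratic_mul hg b (-1) 0 (notMem_ofReal_image_uIcc_of_lt hab hy)
  simp only [neg_mul, one_mul, zero_mul, add_zero, ← sub_eq_add_neg] at h
  rw [h]
  ring

end CauchyTransform

theorem intervalIntegrable_of_continuousOn_of_norm_le {E : Type*} [NormedAddCommGroup E]
    {a b : ℝ} (hab : a ≤ b) {f : ℝ → E} {φ : ℝ → ℝ} (hf : ContinuousOn f (Ioo a b))
    (hφ : IntervalIntegrable φ volume a b) (hle : ∀ x ∈ Ioo a b, ‖f x‖ ≤ φ x) :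
    IntervalIntegrable f volume a b := by
  rw [intervalIntegrable_iff_integrableOn_Ioo_of_le hab] at hφ ⊢
  exact hφ.mono' (hf.aestronglyMeasurable measurableSet_Ioo)
    ((ae_restrict_mem measurableSet_Ioo).mono hle)

theorem tendsto_zero_of_norm_le_of_eq_zero {E : Type*} [SeminormedAddGroup E] {a b : ℝ}
    (hab : a < b) {f : ℝ → E} {φ : ℝ → ℝ}
    (hle : ∀ x ∈ Ioo a b, ‖f x‖ ≤ φ x) (hφ : Continuous φ) (ha : φ a = 0) (hb : φ b = 0) :
    Tendsto f (𝓝[>] a ⊔ 𝓝[<] b) (𝓝 0) := by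
  refine .sup (squeeze_zero_norm' ?_ ((hφ.tendsto' a 0 ha).mono_left nhdsWithin_le_nhds))
    (squeeze_zero_norm' ?_ ((hφ.tendsto' b 0 hb).mono_left nhdsWithin_le_nhds))
  · filter_upwards [Ioo_mem_nhdsGT hab] using hle
  · filter_upwards [Ioo_mem_nhdsLT hab] using hle

theorem notMem_ofReal_image_of_im_ne_zero {z : ℂ} (hz : z.im ≠ 0) (s : Set ℝ) :
    z ∉ Complex.ofReal '' s := by
  rintro ⟨ξ, -, rfl⟩
  exact hz (Complex.ofReal_im ξ)

theorem HasPrincipalValue.const_mul {f : ℝ → ℂ} {a b c : ℝ} {I : ℂ}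
    (h : HasPrincipalValue f a b c I) (k : ℂ) :
    HasPrincipalValue (fun ξ => k * f ξ) a b c (k * I) := by
  refine ⟨fun ε hε => (h.1 ε hε).const_mul k, ?_⟩
  simp only [integral_const_mul]
  exact h.2.const_mul k

section FiniteHilbertTransform

variable {a b x : ℝ} {w : ℝ → ℂ}

theorem Ioo_sdiff_Icc_eq_union {c d : ℝ} (hac : a ≤ d) (hdb : c ≤ b) :
    Ioo a b \ Icc c d = Ioo a c ∪ Ioo d b := by
  ext ξ
  simp only [Set.mem_sdiff, mem_Ioo, mem_Icc, mem_union]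
  grind

theorem setIntegral_Ioo_sdiff_Icc {E : Type*} [NormedAddCommGroup E] [NormedSpace ℝ E]
    {f : ℝ → E} {c d : ℝ} (hac : a ≤ c) (hcd : c ≤ d) (hdb : d ≤ b)
    (hf : IntegrableOn f (Ioo a b \ Icc c d)) :
    ∫ ξ in Ioo a b \ Icc c d, f ξ = (∫ ξ in a..c, f ξ) + ∫ ξ in d..b, f ξ := by
  rw [Ioo_sdiff_Icc_eq_union (hac.trans hcd) (hcd.trans hdb)] at hf ⊢
  have hdisj : Disjoint (Ioo a c) (Ioo d b) :=
    Set.disjoint_left.mpr fun ξ h₁ h₂ => (h₁.2.trans_le hcd).not_gt h₂.1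
  rw [setIntegral_union hdisj measurableSet_Ioo (hf.mono_set subset_union_left)
    (hf.mono_set subset_union_right), intervalIntegral.integral_of_le hac,
    intervalIntegral.integral_of_le hdb, integral_Ioc_eq_integral_Ioo,
    integral_Ioc_eq_integral_Ioo]

theorem tendsto_setIntegral_sdiff_Icc {E : Type*} [NormedAddCommGroup E] [NormedSpace ℝ E]
    {f : ℝ → E} {s : Set ℝ} (hf : IntegrableOn f s) (x : ℝ) :
    Tendsto (fun ε => ∫ ξ in s \ Icc (x - ε) (x + ε), f ξ) (𝓝 0) (𝓝 (∫ ξ in s, f ξ)) := by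
  have hvol : Tendsto (fun ε : ℝ => volume (Icc (x - ε) (x + ε))) (𝓝 0) (𝓝 0) := by
    have h : Continuous fun ε : ℝ => ENNReal.ofReal (x + ε - (x - ε)) :=
      ENNReal.continuous_ofReal.comp (by fun_prop)
    simpa only [Real.volume_Icc] using h.tendsto' 0 0 (by simp)
  have hzero : Tendsto (fun ε => ∫ ξ in Icc (x - ε) (x + ε), f ξ ∂volume.restrict s) (𝓝 0)
      (𝓝 0) :=
    hf.tendsto_setIntegral_nhds_zero
      (tendsto_of_tendsto_of_tendsto_of_le_of_le tendsto_const_nhds hvol (fun _ => zero_le)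
        fun _ => Measure.restrict_apply_le _ _)
  convert! hzero.const_sub (∫ ξ in s, f ξ) using 2 with ε
  · rw [Measure.restrict_restrict measurableSet_Icc, inter_comm, eq_sub_iff_add_eq',
      integral_inter_add_sdiff measurableSet_Icc hf]
  · rw [sub_zero]

theorem integrableOn_sdiff_Icc_div_sub {s : Set ℝ} (hs : MeasurableSet s) (hw : IntegrableOn w s)
    (x : ℝ) {ε : ℝ} (hε : 0 < ε) :
    IntegrableOn (fun ξ : ℝ => w ξ / ((x : ℂ) - ξ)) (s \ Icc (x - ε) (x + ε)) := by
  simp only [div_eq_mul_inv]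
  refine Integrable.mul_bdd (c := ε⁻¹) (hw.mono_set sdiff_subset)
    (Measurable.aestronglyMeasurable (by fun_prop)) ?_
  filter_upwards [ae_restrict_mem (hs.diff measurableSet_Icc)] with ξ hξ
  have hdist : ε ≤ |x - ξ| := by
    by_contra! hlt
    obtain ⟨h₁, h₂⟩ := abs_lt.mp hlt
    exact hξ.2 ⟨by linarith, by linarith⟩
  rw [norm_inv, ← Complex.ofReal_sub, Complex.norm_real, Real.norm_eq_abs]
  gcongr

theorem setIntegral_Ioo_sdiff_Icc_inv_sub {ε : ℝ} (hε : 0 < ε) (ha : a < x - ε) (hb : x + ε < b) :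
    ∫ ξ in Ioo a b \ Icc (x - ε) (x + ε), 1 / ((x : ℂ) - ξ) =
      Real.log ((x - a) / (b - x)) := by
  have hint := integrableOn_sdiff_Icc_div_sub (w := fun _ => 1) (s := Ioo a b) measurableSet_Ioo
    (integrableOn_const (by simp)) x hε
  have hcast (ξ : ℝ) : 1 / ((x : ℂ) - ξ) = ((x - ξ)⁻¹ : ℝ) := by push_cast; rw [one_div]
  rw [setIntegral_Ioo_sdiff_Icc ha.le (by linarith) hb.le hint]
  simp only [hcast, intervalIntegral.integral_ofReal]
  rw [intervalIntegral.integral_comp_sub_left fun t => t⁻¹,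
    intervalIntegral.integral_comp_sub_left fun t => t⁻¹,
    integral_inv_of_pos (by linarith) (by linarith),
    integral_inv_of_neg (by linarith) (by linarith), ← Complex.ofReal_add,
    ← Real.log_mul (div_ne_zero (by linarith) (by linarith))
      (div_ne_zero (by linarith) (by linarith))]
  congr 2
  have h₁ : x - b ≠ 0 := by linarith
  have h₂ : b - x ≠ 0 := by linarith
  rw [sub_sub_cancel, sub_add_cancel_left]
  field_simp
  ring

/-- The finite Hilbert transform of `w` over `(a, b)` at `x`. The singularity of `w(ξ) / (x - ξ)`
is removed by subtracting `w(x)`; the last term is `w(x)` times the principal value of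
`∫ 1 / (x - ξ) dξ`. -/
noncomputable def finiteHilbertTransform (a b : ℝ) (w : ℝ → ℂ) (x : ℝ) : ℂ :=
  (∫ ξ in a..b, (w ξ - w x) / ((x : ℂ) - ξ)) + w x * Real.log ((x - a) / (b - x))

theorem intervalIntegrable_of_difference_quotient
    (hd : IntervalIntegrable (fun ξ => (w ξ - w x) / ((x : ℂ) - ξ)) volume a b) :
    IntervalIntegrable w volume a b := by
  have h : IntervalIntegrable (fun ξ : ℝ => ((x : ℂ) - ξ) * ((w ξ - w x) / ((x : ℂ) - ξ)) + w x)
      volume a b := (hd.continuousOn_mul (by fun_prop)).add intervalIntegrable_const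
  refine h.congr fun ξ _ => ?_
  rcases eq_or_ne ξ x with rfl | hne
  · simp
  · have hne' : (x : ℂ) - ξ ≠ 0 := sub_ne_zero.mpr (Complex.ofReal_injective.ne hne.symm)
    field_simp
    ring

theorem hasPrincipalValue_finiteHilbertTransform (hx : x ∈ Ioo a b)
    (hd : IntervalIntegrable (fun ξ => (w ξ - w x) / ((x : ℂ) - ξ)) volume a b) :
    HasPrincipalValue (fun ξ => w ξ / ((x : ℂ) - ξ)) a b x (finiteHilbertTransform a b w x) := by
  have hab : a ≤ b := (hx.1.trans hx.2).le
  have hw := intervalIntegrable_of_difference_quotient hd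
  rw [intervalIntegrable_iff_integrableOn_Ioo_of_le hab] at hd hw
  refine ⟨fun ε hε => integrableOn_sdiff_Icc_div_sub measurableSet_Ioo hw x hε, ?_⟩
  have hlim := ((tendsto_setIntegral_sdiff_Icc hd x).mono_left nhdsWithin_le_nhds).add_const
    (w x * Real.log ((x - a) / (b - x))) (x := 𝓝[>] 0)
  rw [finiteHilbertTransform, intervalIntegral.integral_of_le hab, integral_Ioc_eq_integral_Ioo]
  refine hlim.congr' ?_
  filter_upwards [Ioo_mem_nhdsGT (lt_min (sub_pos.mpr hx.1) (sub_pos.mpr hx.2))] with ε ⟨hε, hεx⟩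
  obtain ⟨ha, hb⟩ := lt_min_iff.mp hεx
  have hone := integrableOn_sdiff_Icc_div_sub (w := fun _ => 1) (s := Ioo a b) measurableSet_Ioo
    (integrableOn_const (by simp)) x hε
  rw [← setIntegral_Ioo_sdiff_Icc_inv_sub hε (by linarith) (by linarith), ← integral_const_mul,
    ← integral_add (hd.mono_set sdiff_subset) (hone.const_mul (w x))]
  congr 1 with ξ
  ring

theorem tendsto_cauchyTransform_sub_apply
    (hd : IntervalIntegrable (fun ξ => (w ξ - w x) / ((x : ℂ) - ξ)) volume a b) :
    Tendsto (fun y : ℝ => cauchyTransform a b (fun ξ => w ξ - w x) (x + y * Complex.I)) (𝓝 0)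
      (𝓝 (∫ ξ in a..b, (w ξ - w x) / ((x : ℂ) - ξ))) := by
  have hw := (intervalIntegrable_of_difference_quotient hd).aestronglyMeasurable_restrict_uIoc
  have hne {ξ : ℝ} (h : ξ ≠ x) : (x : ℂ) - ξ ≠ 0 :=
    sub_ne_zero.mpr (Complex.ofReal_injective.ne h.symm)
  refine intervalIntegral.tendsto_integral_filter_of_dominated_convergence
    (fun ξ => ‖(w ξ - w x) / ((x : ℂ) - ξ)‖) (.of_forall fun y => ?_)
    (.of_forall fun y => .of_forall fun ξ _ => ?_) hd.norm (.of_forall fun ξ _ => ?_)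
  · simp only [div_eq_mul_inv]
    exact (hw.sub aestronglyMeasurable_const).mul
      (Measurable.aestronglyMeasurable (by fun_prop))
  · rcases eq_or_ne ξ x with rfl | h
    · simp
    have hle : ‖(x : ℂ) - ξ‖ ≤ ‖(x : ℂ) + y * Complex.I - ξ‖ := by
      rw [← Complex.ofReal_sub, Complex.norm_real]
      simpa using Complex.abs_re_le_norm ((x : ℂ) + y * Complex.I - ξ)
    have hpos := norm_pos_iff.mpr (hne h)
    rw [norm_div, norm_div]
    gcongr
  · rcases eq_or_ne ξ x with rfl | h
    · simp
    have hcont : Continuous fun y : ℝ => (x : ℂ) + y * Complex.I - ξ := by fun_prop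
    exact tendsto_const_nhds.div (hcont.tendsto' 0 _ (by simp)) (hne h)

theorem cauchyTransform_one_add_conj (a b x : ℝ) {y : ℝ} (hy : y ≠ 0) :
    cauchyTransform a b (fun _ => 1) (x + y * Complex.I) +
        cauchyTransform a b (fun _ => 1) (x - y * Complex.I) =
      (Real.log ((x - a) ^ 2 + y ^ 2) - Real.log ((x - b) ^ 2 + y ^ 2) : ℝ) := by
  have hpos (ξ : ℝ) : 0 < (x - ξ) ^ 2 + y ^ 2 := by positivity
  have hderiv (ξ : ℝ) : HasDerivAt (fun ξ => -Real.log ((x - ξ) ^ 2 + y ^ 2))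
      (2 * (x - ξ) / ((x - ξ) ^ 2 + y ^ 2)) ξ := by
    convert! (((((hasDerivAt_id ξ).const_sub x).pow 2).add_const (y ^ 2)).log
      (hpos ξ).ne').neg using 1
    simp only [id, Pi.pow_apply]
    ring
  have hFTC := intervalIntegral.integral_eq_sub_of_hasDerivAt (a := a) (b := b)
    (fun ξ _ => hderiv ξ) (Continuous.intervalIntegrable
      (Continuous.div₀ (by fun_prop) (by fun_prop) fun ξ => (hpos ξ).ne') a b)
  rw [neg_sub_neg] at hFTC
  have hplus := notMem_ofReal_image_of_im_ne_zero (z := x + y * Complex.I) (by simpa) [[a, b]]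
  have hminus := notMem_ofReal_image_of_im_ne_zero (z := x - y * Complex.I) (by simpa) [[a, b]]
  rw [← hFTC, ← intervalIntegral.integral_ofReal, cauchyTransform, cauchyTransform,
    ← intervalIntegral.integral_add (intervalIntegrable_div_sub intervalIntegrable_const hplus)
      (intervalIntegrable_div_sub intervalIntegrable_const hminus)]
  refine intervalIntegral.integral_congr fun ξ hξ => ?_
  have h₁ := sub_ofReal_ne_zero hplus hξ
  have h₂ := sub_ofReal_ne_zero hminus hξ
  have h₃ : ((x : ℂ) - ξ) ^ 2 + y ^ 2 ≠ 0 := mod_cast (hpos ξ).ne'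
  push_cast
  field_simp
  linear_combination 2 * (y : ℂ) ^ 2 * (x - ξ) * Complex.I_sq

theorem tendsto_cauchyTransform_one_add_conj (hx : x ∈ Ioo a b) :
    Tendsto (fun y : ℝ => cauchyTransform a b (fun _ => 1) (x + y * Complex.I) +
        cauchyTransform a b (fun _ => 1) (x - y * Complex.I)) (𝓝[>] 0)
      (𝓝 (2 * Real.log ((x - a) / (b - x)))) := by
  have ha : x - a ≠ 0 := by linarith [hx.1]
  have hb : x - b ≠ 0 := by linarith [hx.2]
  have hlog {c : ℝ} (hc : x - c ≠ 0) : Tendsto (fun y : ℝ => Real.log ((x - c) ^ 2 + y ^ 2))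
      (𝓝[>] 0) (𝓝 (2 * Real.log (x - c))) := by
    have hcont : Continuous fun y : ℝ => (x - c) ^ 2 + y ^ 2 := by fun_prop
    have := (hcont.tendsto' 0 ((x - c) ^ 2) (by simp)).log (pow_ne_zero 2 hc)
    rw [Real.log_pow] at this
    exact_mod_cast this.mono_left nhdsWithin_le_nhds
  have hval : 2 * Real.log (x - a) - 2 * Real.log (x - b) = 2 * Real.log ((x - a) / (b - x)) := by
    rw [← neg_sub x b, div_neg, Real.log_neg_eq_log, Real.log_div ha hb]
    ring
  have hlim := (hlog ha).sub (hlog hb)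
  rw [hval] at hlim
  have hlim' := (Complex.continuous_ofReal.tendsto _).comp hlim
  rw [Complex.ofReal_mul, Complex.ofReal_ofNat] at hlim'
  refine hlim'.congr' ?_
  filter_upwards [self_mem_nhdsWithin] with y hy
  exact (cauchyTransform_one_add_conj a b x (ne_of_gt hy)).symm

theorem tendsto_cauchyTransform_add_conj (hx : x ∈ Ioo a b)
    (hd : IntervalIntegrable (fun ξ => (w ξ - w x) / ((x : ℂ) - ξ)) volume a b) :
    Tendsto (fun y : ℝ => cauchyTransform a b w (x + y * Complex.I) +
        cauchyTransform a b w (x - y * Complex.I)) (𝓝[>] 0)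
      (𝓝 (2 * finiteHilbertTransform a b w x)) := by
  have hw := intervalIntegrable_of_difference_quotient hd
  have hupper := tendsto_cauchyTransform_sub_apply hd
  have hlower := hupper.comp (continuous_neg.tendsto' (0 : ℝ) 0 neg_zero)
  have hlim := ((hupper.add hlower).mono_left nhdsWithin_le_nhds).add
    ((tendsto_cauchyTransform_one_add_conj hx).const_mul (w x))
  have hsplit {z : ℂ} (hz : z.im ≠ 0) : cauchyTransform a b w z =
      cauchyTransform a b (fun ξ => w ξ - w x) z + w x * cauchyTransform a b (fun _ => 1) z := by
    rw [← cauchyTransform_const_mul, ← cauchyTransform_add (hw.sub intervalIntegrable_const)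
      intervalIntegrable_const (notMem_ofReal_image_of_im_ne_zero hz _)]
    simp only [mul_one, sub_add_cancel]
  convert! hlim.congr' ?_ using 2
  · rw [finiteHilbertTransform]
    ring
  · filter_upwards [self_mem_nhdsWithin] with y hy
    have hy₀ : y ≠ 0 := ne_of_gt hy
    rw [hsplit (z := x + y * Complex.I) (by simpa), hsplit (z := x - y * Complex.I) (by simpa),
      Function.comp_apply, Complex.ofReal_neg, neg_mul, ← sub_eq_add_neg]
    ring

theorem norm_sub_apply_div_sub_le {w' : ℝ → ℂ} {φ : ℝ → ℝ} {r M : ℝ} (hr : 0 < r)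
    (hball : Metric.ball x r ⊆ Ioo a b) (hw : ∀ ξ ∈ Ioo a b, ‖w ξ‖ ≤ φ ξ)
    (hderiv : ∀ ξ ∈ Metric.ball x r, HasDerivAt w (w' ξ) ξ)
    (hw' : ∀ ξ ∈ Metric.ball x r, ‖w' ξ‖ ≤ M) {ξ : ℝ} (hξ : ξ ∈ Ioo a b) :
    ‖(w ξ - w x) / ((x : ℂ) - ξ)‖ ≤ M + (φ ξ + φ x) / r := by
  have hxr := Metric.mem_ball_self (x := x) hr
  have hφ {η : ℝ} (hη : η ∈ Ioo a b) : 0 ≤ φ η := (norm_nonneg _).trans (hw η hη)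
  have hM : 0 ≤ M := (norm_nonneg _).trans (hw' x hxr)
  have hsum : 0 ≤ φ ξ + φ x := add_nonneg (hφ hξ) (hφ (hball hxr))
  rw [norm_div, ← Complex.ofReal_sub, Complex.norm_real, norm_sub_rev x ξ]
  by_cases hnear : ξ ∈ Metric.ball x r
  · have hmvt := (convex_ball x r).norm_image_sub_le_of_norm_hasDerivWithin_le
      (fun η hη => (hderiv η hη).hasDerivWithinAt) hw' hxr hnear
    exact (div_le_of_le_mul₀ (norm_nonneg _) hM hmvt).trans
      (le_add_of_nonneg_right (div_nonneg hsum hr.le))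
  · rw [Metric.mem_ball, Real.dist_eq, not_lt] at hnear
    refine le_add_of_nonneg_of_le hM (div_le_div₀ hsum ?_ hr hnear)
    exact (norm_sub_le _ _).trans (add_le_add (hw ξ hξ) (hw x (hball hxr)))

end FiniteHilbertTransform

section LegendreProduct

/-- The product `P_ν(z) P_ν(-z)` of two solutions of Legendre's equation. -/
noncomputable def legendreProd (ν z : ℂ) : ℂ := complexLegendreP ν z * complexLegendreP ν (-z)

/-- The component `u V + U v` of the symmetric square for `u = P_ν(z)` and `v = P_ν(-z)`, where `U`
and `V` are the fluxes of `u` and `v`. -/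
noncomputable def legendreProdFlux (ν z : ℂ) : ℂ :=
  complexLegendreP ν z * -legendreFlux ν (-z) + legendreFlux ν z * complexLegendreP ν (-z)

/-- The component `U V` of the symmetric square for `u = P_ν(z)` and `v = P_ν(-z)`, where `U` and
`V` are the fluxes of `u` and `v`. -/
noncomputable def legendreFluxProd (ν z : ℂ) : ℂ := legendreFlux ν z * -legendreFlux ν (-z)

variable {ν : ℂ}

theorem even_legendreProd : Function.Even (legendreProd ν) := fun z => by
  simp only [legendreProd, neg_neg, mul_comm]

theorem odd_legendreProdFlux : Function.Odd (legendreProdFlux ν) := fun z => by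
  simp only [legendreProdFlux, neg_neg]
  ring

theorem even_legendreFluxProd : Function.Even (legendreFluxProd ν) := fun z => by
  simp only [legendreFluxProd, neg_neg]
  ring

theorem neg_mem_Ioo_neg_one_one {x : ℝ} (hx : x ∈ Ioo (-1) 1) : -x ∈ Ioo (-1) 1 :=
  ⟨neg_lt_neg hx.2, neg_lt.mp hx.1⟩

theorem one_sub_ofReal_sq_ne_zero {x : ℝ} (hx : x ∈ Ioo (-1) 1) : 1 - (x : ℂ) ^ 2 ≠ 0 := by
  rw [← Complex.ofReal_pow, ← Complex.ofReal_one, ← Complex.ofReal_sub, Complex.ofReal_ne_zero]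
  nlinarith [hx.1, hx.2]

theorem sturmLiouvilleAt_legendre {z : ℂ} (hz : z ∈ Metric.ball 1 2) (hpz : 1 - z ^ 2 ≠ 0) :
    SturmLiouvilleAt (fun z => 1 - z ^ 2) (ν * (ν + 1)) (complexLegendreP ν) (legendreFlux ν)
      z where
  hasDerivAt := by
    rw [legendreFlux, mul_div_cancel_left₀ _ hpz]
    exact (hasDerivAt_complexLegendreP ν hz).differentiableAt.hasDerivAt
  hasDerivAt_flux := hasDerivAt_legendreFlux ν hz

theorem even_one_sub_sq : Function.Even fun z : ℂ => 1 - z ^ 2 := fun z => by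
  simp only [neg_sq]

theorem sturmLiouvilleAt_legendre_neg {z : ℂ} (hz : -z ∈ Metric.ball 1 2) (hpz : 1 - z ^ 2 ≠ 0) :
    SturmLiouvilleAt (fun z => 1 - z ^ 2) (ν * (ν + 1)) (fun z => complexLegendreP ν (-z))
      (fun z => -legendreFlux ν (-z)) z :=
  (sturmLiouvilleAt_legendre hz (by rwa [neg_sq])).comp_neg even_one_sub_sq

theorem sturmLiouvilleAt_legendre_ofReal {x : ℝ} (hx : x ∈ Ioo (-1) 1) :
    SturmLiouvilleAt (fun z => 1 - z ^ 2) (ν * (ν + 1)) (complexLegendreP ν) (legendreFlux ν) x :=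
  sturmLiouvilleAt_legendre (ofReal_mem_ball_one_two hx) (one_sub_ofReal_sq_ne_zero hx)

theorem sturmLiouvilleAt_legendre_neg_ofReal {x : ℝ} (hx : x ∈ Ioo (-1) 1) :
    SturmLiouvilleAt (fun z => 1 - z ^ 2) (ν * (ν + 1)) (fun z => complexLegendreP ν (-z))
      (fun z => -legendreFlux ν (-z)) x :=
  sturmLiouvilleAt_legendre_neg
    (Complex.ofReal_neg x ▸ ofReal_mem_ball_one_two (neg_mem_Ioo_neg_one_one hx))
    (one_sub_ofReal_sq_ne_zero hx)

theorem symSquareAt_legendreProd {x : ℝ} (hx : x ∈ Ioo (-1) 1) :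
    SymSquareAt (fun z => 1 - z ^ 2) (ν * (ν + 1)) (legendreProd ν) (legendreProdFlux ν)
      (legendreFluxProd ν) x :=
  (sturmLiouvilleAt_legendre_ofReal hx).mul (sturmLiouvilleAt_legendre_neg_ofReal hx)

theorem sqrt_half_mul_sqrt_half {x : ℝ} (hx : x ∈ Ioo (-1) 1) :
    √((1 + x) / 2) * √((1 - x) / 2) = √(1 - x ^ 2) / 2 := by
  rw [← Real.sqrt_mul (by linarith [hx.1]), show (1 + x) / 2 * ((1 - x) / 2) = (1 - x ^ 2) / 2 ^ 2
    by ring, Real.sqrt_div' _ (by positivity), Real.sqrt_sq (by norm_num)]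

section Bounds

variable {K : ℝ} (hK : ∀ n : ℕ, ‖n * legendreCoeff ν n‖ ≤ K) {x : ℝ} (hx : x ∈ Ioo (-1) 1)
include hK hx

theorem norm_complexLegendreP_neg_le :
    ‖complexLegendreP ν (-x)‖ ≤ (1 + 2 * K) / √((1 - x) / 2) := by
  have h := norm_complexLegendreP_le hK (neg_mem_Ioo_neg_one_one hx)
  rwa [Complex.ofReal_neg, ← sub_eq_add_neg] at h

theorem norm_legendreFlux_neg_le : ‖legendreFlux ν (-x)‖ ≤ K * (1 + x) := by
  have h := norm_legendreFlux_le hK (neg_mem_Ioo_neg_one_one hx)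
  rwa [Complex.ofReal_neg, sub_neg_eq_add] at h

theorem norm_legendreProd_le :
    ‖legendreProd ν x‖ ≤ 2 * (1 + 2 * K) ^ 2 * √(1 - x ^ 2)⁻¹ := by
  have hK0 : 0 ≤ K := (norm_nonneg _).trans (hK 0)
  calc ‖legendreProd ν x‖
      ≤ (1 + 2 * K) / √((1 + x) / 2) * ((1 + 2 * K) / √((1 - x) / 2)) := by
        rw [legendreProd, norm_mul]
        gcongr
        · exact norm_complexLegendreP_le hK hx
        · exact norm_complexLegendreP_neg_le hK hx
    _ = 2 * (1 + 2 * K) ^ 2 * √(1 - x ^ 2)⁻¹ := by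
        rw [div_mul_div_comm, sqrt_half_mul_sqrt_half hx, Real.sqrt_inv]
        field_simp

theorem norm_complexLegendreP_mul_legendreFlux_neg_le :
    ‖complexLegendreP ν x * -legendreFlux ν (-x)‖ ≤ 2 * (1 + 2 * K) * K * √((1 + x) / 2) := by
  have hK0 : 0 ≤ K := (norm_nonneg _).trans (hK 0)
  have hpos : 0 < (1 + x) / 2 := by linarith [hx.1]
  calc ‖complexLegendreP ν x * -legendreFlux ν (-x)‖
      ≤ (1 + 2 * K) / √((1 + x) / 2) * (K * (1 + x)) := by
        rw [norm_mul, norm_neg]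
        gcongr
        · exact norm_complexLegendreP_le hK hx
        · exact norm_legendreFlux_neg_le hK hx
    _ = 2 * (1 + 2 * K) * K * √((1 + x) / 2) := by
        have := Real.sqrt_pos.mpr hpos
        field_simp
        rw [Real.sq_sqrt hpos.le]
        ring

theorem norm_legendreProdFlux_le : ‖legendreProdFlux ν x‖ ≤ 4 * (1 + 2 * K) * K := by
  have hK0 : 0 ≤ K := (norm_nonneg _).trans (hK 0)
  have hle {y : ℝ} (hy : y ∈ Ioo (-1) 1) :
      ‖complexLegendreP ν y * -legendreFlux ν (-y)‖ ≤ 2 * (1 + 2 * K) * K := by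
    refine (norm_complexLegendreP_mul_legendreFlux_neg_le hK hy).trans ?_
    exact mul_le_of_le_one_right (by positivity) (Real.sqrt_le_one.mpr (by linarith [hy.2]))
  have hsplit : legendreProdFlux ν x = complexLegendreP ν x * -legendreFlux ν (-x) -
      complexLegendreP ν (-x : ℝ) * -legendreFlux ν (-(-x : ℝ)) := by
    rw [legendreProdFlux, Complex.ofReal_neg, neg_neg]
    ring
  rw [hsplit]
  refine (norm_sub_le_of_le (hle hx) (hle (neg_mem_Ioo_neg_one_one hx))).trans_eq ?_
  ring

theorem norm_legendreFluxProd_le : ‖legendreFluxProd ν x‖ ≤ K ^ 2 * (1 - x ^ 2) := by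
  have hK0 : 0 ≤ K := (norm_nonneg _).trans (hK 0)
  have hpos : 0 ≤ 1 - x := by linarith [hx.2]
  calc ‖legendreFluxProd ν x‖ ≤ K * (1 - x) * (K * (1 + x)) := by
        rw [legendreFluxProd, norm_mul, norm_neg]
        gcongr
        · exact norm_legendreFlux_le hK hx
        · exact norm_legendreFlux_neg_le hK hx
    _ = K ^ 2 * (1 - x ^ 2) := by ring

end Bounds

variable (ν) in
theorem intervalIntegrable_legendreProd :
    IntervalIntegrable (fun x : ℝ => legendreProd ν x) volume (-1) 1 := by
  obtain ⟨K, hK⟩ := exists_norm_mul_legendreCoeff_le ‖ν‖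
  exact intervalIntegrable_of_continuousOn_of_norm_le (by norm_num)
    (fun x hx => (symSquareAt_legendreProd hx).hasDerivAt.comp_ofReal.continuousAt
      |>.continuousWithinAt)
    (Polynomial.Chebyshev.intervalIntegrable_sqrt_one_sub_sq_inv.const_mul _)
    fun x hx => norm_legendreProd_le (hK ν le_rfl) hx

variable (ν) in
theorem intervalIntegrable_legendreProdFlux :
    IntervalIntegrable (fun x : ℝ => legendreProdFlux ν x) volume (-1) 1 := by
  obtain ⟨K, hK⟩ := exists_norm_mul_legendreCoeff_le ‖ν‖
  exact intervalIntegrable_of_continuousOn_of_norm_le (by norm_num)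
    (fun x hx => (symSquareAt_legendreProd hx).hasDerivAt_flux.comp_ofReal.continuousAt
      |>.continuousWithinAt)
    (intervalIntegrable_const (c := 4 * (1 + 2 * K) * K))
    fun x hx => norm_legendreProdFlux_le (hK ν le_rfl) hx

theorem norm_one_sub_ofReal_sq {x : ℝ} (hx : x ∈ Ioo (-1) 1) : ‖1 - (x : ℂ) ^ 2‖ = 1 - x ^ 2 := by
  rw [← Complex.ofReal_pow, ← Complex.ofReal_one, ← Complex.ofReal_sub, Complex.norm_real,
    Real.norm_of_nonneg (by nlinarith [hx.1, hx.2])]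

variable (ν) in
theorem intervalIntegrable_legendreFluxProd_div :
    IntervalIntegrable (fun x : ℝ => legendreFluxProd ν x / (1 - (x : ℂ) ^ 2)) volume (-1) 1 := by
  obtain ⟨K, hK⟩ := exists_norm_mul_legendreCoeff_le ‖ν‖
  refine intervalIntegrable_of_continuousOn_of_norm_le (by norm_num) (fun x hx => ?_)
    (intervalIntegrable_const (c := K ^ 2)) fun x hx => ?_
  · exact ((symSquareAt_legendreProd hx).hasDerivAt_sq_flux.comp_ofReal.continuousAt.div
      (by fun_prop) (one_sub_ofReal_sq_ne_zero hx)).continuousWithinAt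
  · have hpos : 0 < 1 - x ^ 2 := by nlinarith [hx.1, hx.2]
    rw [norm_div, norm_one_sub_ofReal_sq hx, div_le_iff₀ hpos]
    exact norm_legendreFluxProd_le (hK ν le_rfl) hx

theorem legendreFluxProd_eq_one_sub_sq_mul (z : ℂ) :
    legendreFluxProd ν z = (1 - z ^ 2) * (legendreFluxProd ν z / (1 - z ^ 2)) := by
  by_cases hz : 1 - z ^ 2 = 0
  · simp [legendreFluxProd, legendreFlux, hz]
  · rw [mul_div_cancel₀ _ hz]

variable (ν) in
theorem intervalIntegrable_legendreFluxProd :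
    IntervalIntegrable (fun x : ℝ => legendreFluxProd ν x) volume (-1) 1 := by
  rw [funext fun x : ℝ => legendreFluxProd_eq_one_sub_sq_mul (ν := ν) x]
  exact (intervalIntegrable_legendreFluxProd_div ν).continuousOn_mul (by fun_prop)

theorem tendsto_one_sub_sq_mul_legendreProd :
    Tendsto (fun x : ℝ => (1 - (x : ℂ) ^ 2) * legendreProd ν x) (𝓝[>] (-1) ⊔ 𝓝[<] 1) (𝓝 0) := by
  obtain ⟨K, hK⟩ := exists_norm_mul_legendreCoeff_le ‖ν‖
  refine tendsto_zero_of_norm_le_of_eq_zero (φ := fun x => 2 * (1 + 2 * K) ^ 2 * √(1 - x ^ 2))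
    (by norm_num) (fun x hx => ?_) (by fun_prop) (by simp) (by simp)
  have hpos : 0 < 1 - x ^ 2 := by nlinarith [hx.1, hx.2]
  calc ‖(1 - (x : ℂ) ^ 2) * legendreProd ν x‖
      ≤ (1 - x ^ 2) * (2 * (1 + 2 * K) ^ 2 * √(1 - x ^ 2)⁻¹) := by
        rw [norm_mul, norm_one_sub_ofReal_sq hx]
        gcongr
        exact norm_legendreProd_le (hK ν le_rfl) hx
    _ = 2 * (1 + 2 * K) ^ 2 * ((1 - x ^ 2) / √(1 - x ^ 2)) := by
        rw [Real.sqrt_inv]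
        ring
    _ = 2 * (1 + 2 * K) ^ 2 * √(1 - x ^ 2) := by rw [Real.div_sqrt]

theorem tendsto_one_sub_sq_mul_legendreProdFlux :
    Tendsto (fun x : ℝ => (1 - (x : ℂ) ^ 2) * legendreProdFlux ν x) (𝓝[>] (-1) ⊔ 𝓝[<] 1)
      (𝓝 0) := by
  obtain ⟨K, hK⟩ := exists_norm_mul_legendreCoeff_le ‖ν‖
  refine tendsto_zero_of_norm_le_of_eq_zero (φ := fun x => (1 - x ^ 2) * (4 * (1 + 2 * K) * K))
    (by norm_num) (fun x hx => ?_) (by fun_prop) (by simp) (by simp)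
  have hpos : 0 ≤ 1 - x ^ 2 := by nlinarith [hx.1, hx.2]
  rw [norm_mul, norm_one_sub_ofReal_sq hx]
  gcongr
  exact norm_legendreProdFlux_le (hK ν le_rfl) hx

theorem tendsto_legendreFluxProd :
    Tendsto (fun x : ℝ => legendreFluxProd ν x) (𝓝[>] (-1) ⊔ 𝓝[<] 1) (𝓝 0) := by
  obtain ⟨K, hK⟩ := exists_norm_mul_legendreCoeff_le ‖ν‖
  exact tendsto_zero_of_norm_le_of_eq_zero (φ := fun x => K ^ 2 * (1 - x ^ 2)) (by norm_num)
    (fun x hx => norm_legendreFluxProd_le (hK ν le_rfl) hx) (by fun_prop) (by simp) (by simp)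

/-- The Cauchy transform of `P_ν(x) P_ν(-x)`. -/
noncomputable def legendreTransform (ν z : ℂ) : ℂ :=
  cauchyTransform (-1) 1 (fun x => legendreProd ν x) z

/-- The second component of the solution of the symmetric square of Legendre's equation whose first
component is `legendreTransform`. -/
noncomputable def legendreTransformFlux (ν z : ℂ) : ℂ :=
  cauchyTransform (-1) 1 (fun x => legendreProdFlux ν x) z + ∫ x in -1..1, legendreProd ν (x : ℝ)

/-- The third component of the solution of the symmetric square of Legendre's equation whose first
component is `legendreTransform`. -/
noncomputable def legendreTransformSqFlux (ν z : ℂ) : ℂ :=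
  cauchyTransform (-1) 1 (fun x => legendreFluxProd ν x) z -
    ν * (ν + 1) * z * ∫ x in -1..1, legendreProd ν (x : ℝ)

theorem even_comp_ofReal {f : ℂ → ℂ} (hf : Function.Even f) : Function.Even fun x : ℝ => f x :=
  fun x => (congrArg f (Complex.ofReal_neg x)).trans (hf x)

theorem odd_comp_ofReal {f : ℂ → ℂ} (hf : Function.Odd f) : Function.Odd fun x : ℝ => f x :=
  fun x => (congrArg f (Complex.ofReal_neg x)).trans (hf x)

theorem odd_legendreTransform : Function.Odd (legendreTransform ν) :=
  odd_cauchyTransform_of_even (even_comp_ofReal even_legendreProd)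

theorem even_legendreTransformFlux : Function.Even (legendreTransformFlux ν) := fun z => by
  simp only [legendreTransformFlux,
    even_cauchyTransform_of_odd (odd_comp_ofReal odd_legendreProdFlux) z]

theorem odd_legendreTransformSqFlux : Function.Odd (legendreTransformSqFlux ν) := fun z => by
  simp only [legendreTransformSqFlux,
    odd_cauchyTransform_of_even (even_comp_ofReal even_legendreFluxProd) z]
  ring

theorem one_sub_sq_ne_zero_of_notMem {z : ℂ} (hz : z ∉ Complex.ofReal '' [[-1, 1]]) :
    1 - z ^ 2 ≠ 0 := by
  rw [sub_ne_zero, ne_comm, sq_ne_one_iff]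
  exact ⟨fun h => hz ⟨1, right_mem_uIcc, by simp [h]⟩, fun h => hz ⟨-1, left_mem_uIcc, by simp [h]⟩⟩

theorem symSquareAt_legendreTransform {z : ℂ} (hz : z ∉ Complex.ofReal '' [[-1, 1]]) :
    SymSquareAt (fun z => 1 - z ^ 2) (ν * (ν + 1)) (legendreTransform ν) (legendreTransformFlux ν)
      (legendreTransformSqFlux ν) z := by
  have hpz := one_sub_sq_ne_zero_of_notMem hz
  have hflux : ∫ x in -1..1, legendreProdFlux ν (x : ℝ) = 0 :=
    intervalIntegral_eq_zero_of_odd (odd_comp_ofReal odd_legendreProdFlux)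
  have hmoment : ∫ x in -1..1, (x : ℝ) * legendreProd ν (x : ℝ) = 0 :=
    intervalIntegral_eq_zero_of_odd fun x => by
      rw [Complex.ofReal_neg, even_legendreProd, neg_mul]
  convert! symSquareAt_cauchyTransform (α := 1) (β := 0) (γ := -1) (fun z => by ring) (by norm_num)
    (fun x hx => one_sub_ofReal_sq_ne_zero hx) (fun x hx => symSquareAt_legendreProd hx)
    (intervalIntegrable_legendreProd ν) (intervalIntegrable_legendreProdFlux ν)
    (intervalIntegrable_legendreFluxProd ν) tendsto_one_sub_sq_mul_legendreProd
    tendsto_one_sub_sq_mul_legendreProdFlux tendsto_legendreFluxProd hz hpz using 1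
  · ext z
    rw [legendreTransformFlux]
    ring
  · ext z
    rw [legendreTransformSqFlux, hflux, hmoment]
    ring

end LegendreProduct

section FirstIntegrals

variable {ν : ℂ}

/-- The set on which both `P_ν(z)` and `P_ν(-z)` are analytic. -/
def legendreLens : Set ℂ := Metric.ball 1 2 ∩ Metric.ball (-1) 2

theorem isOpen_legendreLens : IsOpen legendreLens := Metric.isOpen_ball.inter Metric.isOpen_ball

theorem convex_legendreLens : Convex ℝ legendreLens := (convex_ball _ _).inter (convex_ball _ _)

theorem neg_mem_ball_one_two {z : ℂ} (hz : z ∈ Metric.ball (-1) 2) : -z ∈ Metric.ball 1 2 := by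
  rwa [mem_ball_iff_norm', sub_neg_eq_add, add_comm, ← sub_neg_eq_add, ← mem_ball_iff_norm]

theorem neg_mem_legendreLens {z : ℂ} (hz : z ∈ legendreLens) : -z ∈ legendreLens := by
  refine ⟨neg_mem_ball_one_two hz.2, ?_⟩
  rw [mem_ball_iff_norm', ← norm_neg, neg_sub, sub_neg_eq_add, neg_add_eq_sub]
  exact mem_ball_iff_norm'.mp hz.1

theorem one_sub_sq_ne_zero_of_mem_legendreLens {z : ℂ} (hz : z ∈ legendreLens) :
    1 - z ^ 2 ≠ 0 := by
  rw [sub_ne_zero, ne_comm, sq_ne_one_iff]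
  constructor <;> rintro rfl
  · have h := mem_ball_iff_norm.mp hz.2
    norm_num at h
  · have h := mem_ball_iff_norm.mp hz.1
    norm_num at h

theorem ofReal_mem_legendreLens {x : ℝ} (hx : x ∈ Ioo (-1) 1) : (x : ℂ) ∈ legendreLens := by
  have h := neg_mem_Ioo_neg_one_one hx
  refine ⟨ofReal_mem_ball_one_two hx, ?_⟩
  have hneg := mem_ball_iff_norm'.mp (ofReal_mem_ball_one_two h)
  rwa [mem_ball_iff_norm, sub_neg_eq_add, add_comm, ← sub_neg_eq_add, ← Complex.ofReal_neg]

theorem continuousAt_complexLegendreP {z : ℂ} (hz : z ∈ Metric.ball 1 2) :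
    ContinuousAt (complexLegendreP ν) z :=
  (hasDerivAt_complexLegendreP ν hz).continuousAt

theorem tendsto_complexLegendreP_one :
    Tendsto (fun x : ℝ => complexLegendreP ν x) (𝓝 1) (𝓝 1) := by
  have h := (continuousAt_complexLegendreP (ν := ν) (Metric.mem_ball_self two_pos)).tendsto
  rw [complexLegendreP_one] at h
  exact h.comp (Complex.continuous_ofReal.tendsto' 1 1 Complex.ofReal_one)

theorem tendsto_complexLegendreP_mul_legendreFlux_neg_right :
    Tendsto (fun x : ℝ => complexLegendreP ν x * -legendreFlux ν (-x)) (𝓝[<] 1)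
      (𝓝 (-(2 * Complex.sin (ν * Real.pi) / Real.pi))) := by
  have hneg := (tendsto_legendreFlux_neg_one ν).comp (tendsto_neg_nhdsLT (a := 1))
  simpa [Function.comp_def] using
    (tendsto_complexLegendreP_one.mono_left nhdsWithin_le_nhds).mul hneg.neg

theorem tendsto_complexLegendreP_mul_legendreFlux_neg_left :
    Tendsto (fun x : ℝ => complexLegendreP ν x * -legendreFlux ν (-x)) (𝓝[>] (-1)) (𝓝 0) := by
  obtain ⟨K, hK⟩ := exists_norm_mul_legendreCoeff_le ‖ν‖
  refine squeeze_zero_norm' (a := fun x => 2 * (1 + 2 * K) * K * √((1 + x) / 2)) ?_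
    ((Continuous.tendsto' (by fun_prop) _ _ (by simp)).mono_left nhdsWithin_le_nhds)
  filter_upwards [Ioo_mem_nhdsGT (show (-1 : ℝ) < 1 by norm_num)] with x hx
  exact norm_complexLegendreP_mul_legendreFlux_neg_le (hK ν le_rfl) hx

theorem integral_legendreFluxProd_div_sub :
    (∫ x in -1..1, legendreFluxProd ν (x : ℝ) / (1 - (x : ℂ) ^ 2)) -
      ν * (ν + 1) * ∫ x in -1..1, legendreProd ν (x : ℝ) =
    -(2 * Complex.sin (ν * Real.pi) / Real.pi) := by
  have hint := (intervalIntegrable_legendreProd ν).const_mul (ν * (ν + 1))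
  rw [← intervalIntegral.integral_const_mul, ← intervalIntegral.integral_sub
    (intervalIntegrable_legendreFluxProd_div ν) hint]
  refine (intervalIntegral.integral_eq_sub_of_hasDerivAt_of_tendsto (by norm_num) (fun x hx => ?_)
    ((intervalIntegrable_legendreFluxProd_div ν).sub hint)
    tendsto_complexLegendreP_mul_legendreFlux_neg_left
    tendsto_complexLegendreP_mul_legendreFlux_neg_right).trans (sub_zero _)
  convert! ((sturmLiouvilleAt_legendre_ofReal hx).hasDerivAt.mul
    (sturmLiouvilleAt_legendre_neg_ofReal hx).hasDerivAt_flux).comp_ofReal using 1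
  rw [legendreFluxProd, legendreProd]
  ring

theorem wronskian_legendre {z : ℂ} (hz : z ∈ legendreLens) :
    complexLegendreP ν z * -legendreFlux ν (-z) - legendreFlux ν z * complexLegendreP ν (-z) =
      -(2 * Complex.sin (ν * Real.pi) / Real.pi) := by
  have hconst {y : ℂ} (hy : y ∈ legendreLens) := eq_of_forall_hasDerivAt_zero isOpen_legendreLens
    convex_legendreLens.isPreconnected (fun y hy =>
      (sturmLiouvilleAt_legendre (ν := ν) hy.1
        (one_sub_sq_ne_zero_of_mem_legendreLens hy)).hasDerivAt_wronskian
      (sturmLiouvilleAt_legendre_neg (neg_mem_ball_one_two hy.2)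
        (one_sub_sq_ne_zero_of_mem_legendreLens hy))) hz hy
  have hlim := (tendsto_complexLegendreP_mul_legendreFlux_neg_right (ν := ν)).add
    ((tendsto_complexLegendreP_mul_legendreFlux_neg_left (ν := ν)).comp
      (tendsto_neg_nhdsLT (a := (1 : ℝ))))
  rw [add_zero] at hlim
  refine tendsto_nhds_unique (tendsto_const_nhds.congr' ?_) hlim
  filter_upwards [Ioo_mem_nhdsLT (show (-1 : ℝ) < 1 by norm_num)] with x hx
  rw [hconst (ofReal_mem_legendreLens hx), Function.comp_apply, Complex.ofReal_neg, neg_neg]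
  ring

theorem tendsto_legendreFlux_mul_cauchyTransform {g : ℝ → ℂ}
    (hg : IntervalIntegrable g volume (-1) 1) :
    Tendsto (fun y : ℝ => legendreFlux ν y * cauchyTransform (-1) 1 g y) (𝓝[>] 1) (𝓝 0) := by
  have hofReal : Tendsto Complex.ofReal (𝓝[>] 1) (𝓝[≠] 1) := by
    refine tendsto_nhdsWithin_iff.mpr ⟨?_, ?_⟩
    · exact (Complex.continuous_ofReal.tendsto' 1 1 Complex.ofReal_one).mono_left
        nhdsWithin_le_nhds
    · filter_upwards [self_mem_nhdsWithin] with y hy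
      simpa using ne_of_gt (mem_Ioi.mp hy)
  have hslope :=
    (hasDerivAt_legendreFlux ν (Metric.mem_ball_self two_pos)).tendsto_slope.comp hofReal
  have hlim := hslope.mul (tendsto_sub_mul_cauchyTransform (by norm_num) hg)
  rw [mul_zero] at hlim
  refine hlim.congr' ?_
  filter_upwards [self_mem_nhdsWithin] with y hy
  have hne : (y : ℂ) - 1 ≠ 0 := by
    rw [sub_ne_zero, Complex.ofReal_ne_one]
    exact ne_of_gt hy
  rw [Function.comp_apply, slope_def_field, legendreFlux_one, Complex.ofReal_one]
  field_simp
  ring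

theorem tendsto_cauchyTransform_legendreFluxProd :
    Tendsto (fun y : ℝ => cauchyTransform (-1) 1 (fun x => legendreFluxProd ν x) y) (𝓝[>] 1)
      (𝓝 (∫ x in -1..1, legendreFluxProd ν (x : ℝ) / (1 - (x : ℂ) ^ 2))) := by
  have hint := intervalIntegrable_legendreFluxProd_div ν
  have hint' := intervalIntegrable_ofReal_mul hint
  have hlim := tendsto_cauchyTransform_sub_mul (by norm_num) (hint.add hint')
  have hodd : ∫ x in -1..1, (x : ℝ) * (legendreFluxProd ν (x : ℝ) / (1 - (x : ℂ) ^ 2)) = 0 :=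
    intervalIntegral_eq_zero_of_odd fun x => by
      rw [Complex.ofReal_neg, even_legendreFluxProd, neg_sq, neg_mul]
  rw [intervalIntegral.integral_add hint hint', hodd, add_zero] at hlim
  convert! hlim using 4 with y x
  rw [Complex.ofReal_one]
  linear_combination legendreFluxProd_eq_one_sub_sq_mul (ν := ν) x

/-- The disc of analyticity of `P_ν(z)`, cut along `(-1, 1]`. -/
def legendreCutDisc : Set ℂ := Metric.ball 1 2 ∩ (fun z => z + -1) ⁻¹' Complex.slitPlane

theorem isOpen_legendreCutDisc : IsOpen legendreCutDisc :=
  Metric.isOpen_ball.inter (Complex.isOpen_slitPlane.preimage (by fun_prop))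

theorem isPreconnected_legendreCutDisc : IsPreconnected legendreCutDisc := by
  have hmem : (2 : ℂ) ∈ Metric.ball 1 2 := by
    rw [mem_ball_iff_norm]
    norm_num
  have hslit : StarConvex ℝ 2 ((fun z : ℂ => z + -1) ⁻¹' Complex.slitPlane) :=
    StarConvex.preimage_add_left (by norm_num [Complex.starConvex_one_slitPlane])
  have hmem' : (2 : ℂ) ∈ legendreCutDisc := by
    refine ⟨hmem, Or.inl ?_⟩
    norm_num
  exact ((((convex_ball _ _).starConvex hmem).inter hslit).isPathConnected
    hmem').isConnected.isPreconnected

theorem notMem_ofReal_image_of_mem_legendreCutDisc {z : ℂ} (hz : z ∈ legendreCutDisc) :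
    z ∉ Complex.ofReal '' [[-1, 1]] := by
  rintro ⟨x, hx, rfl⟩
  have h : (x : ℂ) + -1 ∈ Complex.slitPlane := hz.2
  rw [uIcc_of_le (by norm_num)] at hx
  rw [← Complex.ofReal_one, ← Complex.ofReal_neg, ← Complex.ofReal_add,
    Complex.ofReal_mem_slitPlane] at h
  linarith [hx.2]

theorem mem_legendreCutDisc_of_im_ne_zero {z : ℂ} (hz : z ∈ Metric.ball 1 2) (him : z.im ≠ 0) :
    z ∈ legendreCutDisc :=
  ⟨hz, Or.inr (by simpa using him)⟩

/-- The first integral of the symmetric square of Legendre's equation that pairs `legendreTransform`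
with the pairs `(u, U)` and `(v, V)`. -/
noncomputable def legendrePairing (ν : ℂ) (u U v V : ℂ → ℂ) : ℂ → ℂ :=
  symSquarePairing (legendreTransform ν) (legendreTransformFlux ν) (legendreTransformSqFlux ν)
    u U v V

theorem tendsto_legendrePairing_self :
    Tendsto (fun y : ℝ => legendrePairing ν (complexLegendreP ν) (legendreFlux ν)
      (complexLegendreP ν) (legendreFlux ν) y) (𝓝[>] 1)
      (𝓝 (2 * -(2 * Complex.sin (ν * Real.pi) / Real.pi))) := by
  have hofReal : Tendsto Complex.ofReal (𝓝[>] 1) (𝓝 1) :=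
    (Complex.continuous_ofReal.tendsto' 1 1 Complex.ofReal_one).mono_left nhdsWithin_le_nhds
  have hP : Tendsto (fun y : ℝ => complexLegendreP ν y) (𝓝[>] 1) (𝓝 1) :=
    tendsto_complexLegendreP_one.mono_left nhdsWithin_le_nhds
  have hF : Tendsto (fun y : ℝ => legendreFlux ν y) (𝓝[>] 1) (𝓝 0) := by
    have h := (hasDerivAt_legendreFlux ν (Metric.mem_ball_self two_pos)).continuousAt.tendsto
    rw [legendreFlux_one] at h
    exact h.comp hofReal
  have hFG := tendsto_legendreFlux_mul_cauchyTransform (intervalIntegrable_legendreProd ν) (ν := ν)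
  have hFH := (tendsto_legendreFlux_mul_cauchyTransform (intervalIntegrable_legendreProdFlux ν)
    (ν := ν)).add (hF.mul_const (∫ x in -1..1, legendreProd ν (x : ℝ)))
  have hK := (tendsto_cauchyTransform_legendreFluxProd (ν := ν)).sub
    ((hofReal.const_mul (ν * (ν + 1))).mul_const (∫ x in -1..1, legendreProd ν (x : ℝ)))
  rw [mul_one, integral_legendreFluxProd_div_sub] at hK
  convert! (((hF.const_mul 2).mul hFG).sub ((hP.const_mul 2).mul hFH)).add
    (((hP.mul hP).const_mul 2).mul hK) using 2
  · simp only [legendrePairing, symSquarePairing, legendreTransform, legendreTransformFlux,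
      legendreTransformSqFlux]
    ring
  · ring

theorem legendrePairing_self {z : ℂ} (hz : z ∈ legendreCutDisc) :
    legendrePairing ν (complexLegendreP ν) (legendreFlux ν)
      (complexLegendreP ν) (legendreFlux ν) z = 2 * -(2 * Complex.sin (ν * Real.pi) / Real.pi) := by
  have hderiv (y) (hy : y ∈ legendreCutDisc) : HasDerivAt (legendrePairing ν
      (complexLegendreP ν) (legendreFlux ν) (complexLegendreP ν) (legendreFlux ν)) 0 y := by
    have hoff := notMem_ofReal_image_of_mem_legendreCutDisc hy
    have hP := sturmLiouvilleAt_legendre (ν := ν) hy.1 (one_sub_sq_ne_zero_of_notMem hoff)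
    exact (symSquareAt_legendreTransform hoff).hasDerivAt_symSquarePairing hP hP
  refine tendsto_nhds_unique (tendsto_const_nhds.congr' ?_) tendsto_legendrePairing_self
  filter_upwards [Ioo_mem_nhdsGT (show (1 : ℝ) < 3 by norm_num)] with y hy
  refine eq_of_forall_hasDerivAt_zero isOpen_legendreCutDisc isPreconnected_legendreCutDisc hderiv
    hz ⟨?_, ?_⟩
  · rw [mem_ball_iff_norm, ← Complex.ofReal_one, ← Complex.ofReal_sub, Complex.norm_real,
      Real.norm_of_nonneg (by linarith [hy.1])]
    linarith [hy.2]
  · refine Or.inl ?_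
    simpa using hy.1

theorem legendrePairing_neg_self {z : ℂ} (hz : -z ∈ legendreCutDisc) :
    legendrePairing ν (fun z => complexLegendreP ν (-z)) (fun z => -legendreFlux ν (-z))
      (fun z => complexLegendreP ν (-z)) (fun z => -legendreFlux ν (-z)) z =
      -(2 * -(2 * Complex.sin (ν * Real.pi) / Real.pi)) := by
  rw [← legendrePairing_self hz]
  exact symSquarePairing_comp_neg odd_legendreTransform even_legendreTransformFlux
    odd_legendreTransformSqFlux z

theorem exists_legendrePairing_cross_eq (ν : ℂ) :
    ∃ b : ℂ, ∀ z ∈ legendreLens, 0 < z.im →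
      legendrePairing ν (complexLegendreP ν) (legendreFlux ν) (fun z => complexLegendreP ν (-z))
        (fun z => -legendreFlux ν (-z)) z = b := by
  have hbase (c : ℂ) (hc : ‖c‖ = 1) : Complex.I / 2 ∈ Metric.ball c 2 := by
    rw [mem_ball_iff_norm]
    refine (norm_sub_le _ _).trans_lt ?_
    rw [norm_div, Complex.norm_I, Complex.norm_ofNat, hc]
    norm_num
  refine ⟨_, fun z hz him => eq_of_forall_hasDerivAt_zero (y := z) (z := Complex.I / 2)
    (isOpen_legendreLens.inter (isOpen_lt continuous_const Complex.continuous_im))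
    (convex_legendreLens.inter (convex_halfSpace_im_gt 0)).isPreconnected ?_ ⟨hz, him⟩ ⟨?_, ?_⟩⟩
  · rintro y ⟨hy, hyim⟩
    have hpy := one_sub_sq_ne_zero_of_mem_legendreLens hy
    exact (symSquareAt_legendreTransform
      (notMem_ofReal_image_of_im_ne_zero hyim.ne' _)).hasDerivAt_symSquarePairing
      (sturmLiouvilleAt_legendre hy.1 hpy)
      (sturmLiouvilleAt_legendre_neg (neg_mem_ball_one_two hy.2) hpy)
  · exact ⟨hbase 1 (by simp), hbase (-1) (by simp)⟩
  · norm_num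

theorem exists_legendreTransform_eq (hν : Complex.sin (ν * Real.pi) ≠ 0) :
    ∃ b : ℂ, ∀ z ∈ legendreLens, 0 < z.im → legendreTransform ν z =
      Real.pi / (2 * Complex.sin (ν * Real.pi)) *
        (complexLegendreP ν z ^ 2 - complexLegendreP ν (-z) ^ 2) +
      b * (complexLegendreP ν z * complexLegendreP ν (-z)) := by
  obtain ⟨b, hb⟩ := exists_legendrePairing_cross_eq ν
  have hpi : (Real.pi : ℂ) ≠ 0 := Complex.ofReal_ne_zero.mpr Real.pi_ne_zero
  refine ⟨-b * (Real.pi / (2 * Complex.sin (ν * Real.pi))) ^ 2, fun z hz him => ?_⟩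
  have h := two_mul_wronskian_sq_mul (legendreTransform ν) (legendreTransformFlux ν)
    (legendreTransformSqFlux ν) (complexLegendreP ν) (legendreFlux ν)
    (fun z => complexLegendreP ν (-z)) (fun z => -legendreFlux ν (-z)) z
  have huu := legendrePairing_self (ν := ν) (mem_legendreCutDisc_of_im_ne_zero hz.1 him.ne')
  have hvv := legendrePairing_neg_self (ν := ν) (mem_legendreCutDisc_of_im_ne_zero
    (neg_mem_ball_one_two hz.2) (by simpa using him.ne'))
  have huv := hb z hz him
  rw [legendrePairing] at huu hvv huv
  rw [wronskian_legendre hz, huu, hvv, huv] at h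
  field_simp at h ⊢
  linear_combination h

theorem tendsto_legendreTransform_add (hν : Complex.sin (ν * Real.pi) ≠ 0) {x : ℝ}
    (hx : x ∈ Ioo (-1) 1) :
    Tendsto (fun y : ℝ => legendreTransform ν (x + y * Complex.I) +
        legendreTransform ν (x - y * Complex.I)) (𝓝[>] 0)
      (𝓝 (2 * (Real.pi / (2 * Complex.sin (ν * Real.pi)) *
        (legendreP ν x ^ 2 - legendreP ν (-x) ^ 2)))) := by
  obtain ⟨b, hb⟩ := exists_legendreTransform_eq hν
  have hlim (x : ℝ) (hx : x ∈ Ioo (-1) 1) : Tendsto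
      (fun y : ℝ => legendreTransform ν (x + y * Complex.I)) (𝓝[>] 0)
      (𝓝 (Real.pi / (2 * Complex.sin (ν * Real.pi)) *
        (complexLegendreP ν x ^ 2 - complexLegendreP ν (-x) ^ 2) +
      b * (complexLegendreP ν x * complexLegendreP ν (-x)))) := by
    have hvert : Tendsto (fun y : ℝ => (x : ℂ) + y * Complex.I) (𝓝[>] 0) (𝓝 x) :=
      (Continuous.tendsto' (by fun_prop) _ _ (by simp)).mono_left nhdsWithin_le_nhds
    have hlens := ofReal_mem_legendreLens hx
    have hP := (continuousAt_complexLegendreP (ν := ν) hlens.1).tendsto.comp hvert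
    have hPneg := (continuousAt_complexLegendreP (ν := ν)
      (neg_mem_legendreLens hlens).1).tendsto.comp hvert.neg
    refine ((((hP.pow 2).sub (hPneg.pow 2)).const_mul _).add
      ((hP.mul hPneg).const_mul b)).congr' ?_
    filter_upwards [hvert.eventually_mem (isOpen_legendreLens.mem_nhds hlens),
      self_mem_nhdsWithin] with y hy hpos
    exact (hb _ hy (by simpa using hpos)).symm
  have hsum := (hlim x hx).sub (hlim (-x) (neg_mem_Ioo_neg_one_one hx))
  convert! hsum using 2
  · rw [sub_eq_add_neg (legendreTransform _ _), ← odd_legendreTransform, Complex.ofReal_neg,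
      neg_add, neg_neg, ← sub_eq_add_neg]
  · rw [Complex.ofReal_neg, neg_neg]
    change _ * (_ * (complexLegendreP ν x ^ 2 - complexLegendreP ν (-x : ℝ) ^ 2)) = _
    rw [Complex.ofReal_neg]
    ring

end FirstIntegrals

section LegendreHilbertTransform

variable {ν : ℂ} {x : ℝ}

theorem mem_Ioo_and_le_one_sub_sq_of_mem_ball {y : ℝ} (hx : x ∈ Ioo (-1) 1)
    (hy : y ∈ Metric.ball x ((1 - |x|) / 2)) :
    y ∈ Ioo (-1) 1 ∧ (1 - |x|) / 2 ≤ 1 - y ^ 2 := by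
  have hx1 : |x| < 1 := abs_lt.mpr hx
  have hy1 : |y| ≤ 1 - (1 - |x|) / 2 := by
    rw [Metric.mem_ball, Real.dist_eq] at hy
    linarith [abs_sub_abs_le_abs_sub y x]
  refine ⟨abs_lt.mp (by linarith), ?_⟩
  rw [← sq_abs y]
  nlinarith [abs_nonneg y]

theorem exists_norm_legendreProd_sub_div_sub_le (hx : x ∈ Ioo (-1) 1) (R : ℝ) :
    ∃ φ : ℝ → ℝ, IntervalIntegrable φ volume (-1) 1 ∧ ∀ ν : ℂ, ‖ν‖ ≤ R → ∀ ξ ∈ Ioo (-1 : ℝ) 1,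
      ‖(legendreProd ν ξ - legendreProd ν x) / ((x : ℂ) - ξ)‖ ≤ φ ξ := by
  obtain ⟨K, hK⟩ := exists_norm_mul_legendreCoeff_le R
  have hr : 0 < (1 - |x|) / 2 := by linarith [abs_lt.mpr hx]
  have hφ : IntervalIntegrable (fun ξ : ℝ => 2 * (1 + 2 * K) ^ 2 * √(1 - ξ ^ 2)⁻¹) volume (-1) 1 :=
    Polynomial.Chebyshev.intervalIntegrable_sqrt_one_sub_sq_inv.const_mul _
  refine ⟨fun ξ => 4 * (1 + 2 * K) * K / ((1 - |x|) / 2) +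
      (2 * (1 + 2 * K) ^ 2 * √(1 - ξ ^ 2)⁻¹ + 2 * (1 + 2 * K) ^ 2 * √(1 - x ^ 2)⁻¹) /
        ((1 - |x|) / 2),
    intervalIntegrable_const.add ((hφ.add intervalIntegrable_const).div_const _),
    fun ν hν ξ hξ => norm_sub_apply_div_sub_le hr
      (w := fun ξ : ℝ => legendreProd ν ξ)
      (fun y hy => (mem_Ioo_and_le_one_sub_sq_of_mem_ball hx hy).1)
      (fun y hy => norm_legendreProd_le (hK ν hν) hy)
      (fun y hy => (symSquareAt_legendreProd
        (mem_Ioo_and_le_one_sub_sq_of_mem_ball hx hy).1).hasDerivAt.comp_ofReal)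
      (fun y hy => ?_) hξ⟩
  obtain ⟨hy1, hy2⟩ := mem_Ioo_and_le_one_sub_sq_of_mem_ball hx hy
  have hflux := norm_legendreProdFlux_le (hK ν hν) hy1
  rw [norm_div, norm_one_sub_ofReal_sq hy1]
  exact div_le_div₀ ((norm_nonneg _).trans hflux) hflux hr hy2

variable (ν x) in
theorem aestronglyMeasurable_legendreProd_sub_div_sub :
    AEStronglyMeasurable (fun ξ : ℝ => (legendreProd ν ξ - legendreProd ν x) / ((x : ℂ) - ξ))
      (volume.restrict (Ι (-1) 1)) := by
  have hinv : Measurable fun ξ : ℝ => ((x : ℂ) - ξ)⁻¹ := by fun_prop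
  simp_rw [div_eq_mul_inv]
  exact ((intervalIntegrable_legendreProd ν).aestronglyMeasurable_restrict_uIoc.sub
    aestronglyMeasurable_const).mul hinv.aestronglyMeasurable

theorem ae_restrict_uIoc_of_forall_mem_Ioo {a b : ℝ} {p : ℝ → Prop} (hab : a ≤ b)
    (hp : ∀ ξ ∈ Ioo a b, p ξ) : ∀ᵐ ξ ∂volume.restrict (Ι a b), p ξ := by
  rw [uIoc_of_le hab, ← restrict_Ioo_eq_restrict_Ioc]
  exact ae_restrict_of_forall_mem measurableSet_Ioo hp

variable (ν) in
theorem intervalIntegrable_legendreProd_sub_div_sub (hx : x ∈ Ioo (-1) 1) :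
    IntervalIntegrable (fun ξ : ℝ => (legendreProd ν ξ - legendreProd ν x) / ((x : ℂ) - ξ))
      volume (-1) 1 := by
  obtain ⟨φ, hφ, hle⟩ := exists_norm_legendreProd_sub_div_sub_le hx ‖ν‖
  exact hφ.mono_fun' (aestronglyMeasurable_legendreProd_sub_div_sub ν x)
    (ae_restrict_uIoc_of_forall_mem_Ioo (by norm_num) (hle ν le_rfl))

/-- The finite Hilbert transform over `(-1, 1)` of `ξ ↦ P_ν(ξ) P_ν(-ξ)`. -/
noncomputable def legendreHilbertTransform (ν : ℂ) (x : ℝ) : ℂ :=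
  finiteHilbertTransform (-1) 1 (fun ξ : ℝ => legendreProd ν ξ) x

variable (ν) in
theorem hasPrincipalValue_legendreHilbertTransform (hx : x ∈ Ioo (-1) 1) :
    HasPrincipalValue (fun ξ : ℝ => legendreProd ν ξ / ((x : ℂ) - ξ)) (-1) 1 x
      (legendreHilbertTransform ν x) :=
  hasPrincipalValue_finiteHilbertTransform hx (intervalIntegrable_legendreProd_sub_div_sub ν hx)

theorem legendreHilbertTransform_eq (hν : Complex.sin (ν * Real.pi) ≠ 0) (hx : x ∈ Ioo (-1) 1) :
    legendreHilbertTransform ν x = Real.pi / (2 * Complex.sin (ν * Real.pi)) *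
      (legendreP ν x ^ 2 - legendreP ν (-x) ^ 2) :=
  mul_left_cancel₀ two_ne_zero (tendsto_nhds_unique
    (tendsto_cauchyTransform_add_conj hx (intervalIntegrable_legendreProd_sub_div_sub ν hx))
    (tendsto_legendreTransform_add hν hx))

theorem sin_mul_pi_ne_zero (hν : ∀ k : ℤ, ν ≠ k) : Complex.sin (ν * Real.pi) ≠ 0 := by
  rw [Ne, Complex.sin_eq_zero_iff]
  rintro ⟨k, hk⟩
  exact hν k (mul_right_cancel₀ (Complex.ofReal_ne_zero.mpr Real.pi_ne_zero) hk)

variable (ν x) in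
theorem legendreProd_ofReal : legendreProd ν x = legendreP ν x * legendreP ν (-x) := by
  change complexLegendreP ν x * complexLegendreP ν (-x) =
    complexLegendreP ν x * complexLegendreP ν ((-x : ℝ) : ℂ)
  rw [Complex.ofReal_neg]

theorem hasPrincipalValue_legendreP_mul_legendreP_neg (hν : ∀ k : ℤ, ν ≠ k)
    (hx : x ∈ Ioo (-1) 1) :
    HasPrincipalValue
      (fun ξ : ℝ => 2 * legendreP ν ξ * legendreP ν (-ξ) / (Real.pi * ((x : ℂ) - ξ)))
      (-1) 1 x ((legendreP ν x ^ 2 - legendreP ν (-x) ^ 2) / Complex.sin (ν * Real.pi)) := by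
  have hsin := sin_mul_pi_ne_zero hν
  have hpi : (Real.pi : ℂ) ≠ 0 := Complex.ofReal_ne_zero.mpr Real.pi_ne_zero
  convert! (hasPrincipalValue_legendreHilbertTransform ν hx).const_mul (2 / Real.pi) using 1
  · ext ξ
    rw [legendreProd_ofReal, mul_assoc, mul_div_mul_comm]
  · rw [legendreHilbertTransform_eq hsin hx]
    field_simp

end LegendreHilbertTransform

section IntegerDegree

theorem legendreCoeff_natCast (n k : ℕ) :
    legendreCoeff n k = (-1) ^ k * n.choose k * (n + k).choose n := by
  induction k with
  | zero => simp [legendreCoeff_zero]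
  | succ k ih =>
    have hchoose : (n.choose (k + 1) : ℂ) * (k + 1) = n.choose k * (n - k) := by
      rcases le_or_gt k n with hkn | hkn
      · rw [← Nat.cast_sub hkn]
        exact_mod_cast Nat.choose_succ_right_eq n k
      · rw [Nat.choose_eq_zero_of_lt hkn, Nat.choose_eq_zero_of_lt (by lia)]
        simp
    have hchoose_add : ((n + (k + 1)).choose n : ℂ) * (k + 1) =
        (n + k).choose n * (n + k + 1) := by
      have h := Nat.choose_mul_succ_eq (n + k) n
      rw [show n + k + 1 - n = k + 1 by lia] at h
      exact_mod_cast h.symm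
    have hne : ((k : ℂ) + 1) ^ 2 ≠ 0 := pow_ne_zero 2 (Nat.cast_add_one_ne_zero k)
    rw [← mul_right_inj' hne, legendreCoeff_succ, ih]
    linear_combination (-1) ^ k * (n.choose (k + 1) : ℂ) * (k + 1) * hchoose_add +
      (-1) ^ k * ((n + k).choose n : ℂ) * (n + k + 1) * hchoose

theorem complexLegendreP_natCast (n : ℕ) (z : ℂ) :
    complexLegendreP n z = Polynomial.aeval ((1 - z) / 2) (Polynomial.shiftedLegendre n) := by
  rw [complexLegendreP_eq_tsum, Polynomial.aeval_eq_sum_range, Polynomial.natDegree_shiftedLegendre,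
    tsum_eq_sum (s := Finset.range (n + 1))]
  · refine Finset.sum_congr rfl fun k _ => ?_
    rw [legendreCoeff_natCast, Polynomial.coeff_shiftedLegendre, zsmul_eq_mul]
    push_cast
    ring
  · intro k hk
    rw [Finset.mem_range, not_lt] at hk
    rw [legendreCoeff_natCast, Nat.choose_eq_zero_of_lt (by lia)]
    simp

theorem complexLegendreP_natCast_neg (n : ℕ) (z : ℂ) :
    complexLegendreP n (-z) = (-1) ^ n * complexLegendreP n z := by
  rw [complexLegendreP_natCast, complexLegendreP_natCast, Polynomial.shiftedLegendre_eval_symm]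
  ring_nf

theorem legendreP_natCast_neg (n : ℕ) (x : ℝ) :
    legendreP n (-x) = (-1) ^ n * legendreP n x := by
  change complexLegendreP n ((-x : ℝ) : ℂ) = _ * complexLegendreP n x
  rw [Complex.ofReal_neg, complexLegendreP_natCast_neg]

theorem differentiable_legendreP_degree {x : ℝ} (hx : x ∈ Ioo (-1) 1) :
    Differentiable ℂ fun ν => legendreP ν x := fun ν => by
  obtain ⟨K, hK⟩ := exists_norm_mul_legendreCoeff_le (‖ν‖ + 1)
  have hs := norm_one_sub_div_two_lt_one (ofReal_mem_ball_one_two hx)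
  change DifferentiableAt ℂ (fun ν => complexLegendreP ν x) ν
  simp only [complexLegendreP_eq_tsum]
  refine (Complex.differentiableOn_tsum_of_summable_norm
    (u := fun n => (1 + K) * ‖(1 - (x : ℂ)) / 2‖ ^ n)
    ((summable_geometric_of_lt_one (norm_nonneg _) hs).mul_left _)
    (fun n => ((differentiable_legendreCoeff n).mul_const _).differentiableOn)
    Metric.isOpen_ball fun n w hw => ?_).differentiableAt
    (Metric.isOpen_ball.mem_nhds (x := ν) (mem_ball_zero_iff.mpr (lt_add_one ‖ν‖)))
  rw [norm_mul, norm_pow]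
  gcongr
  exact norm_legendreCoeff_le (hK w (mem_ball_zero_iff.mp hw).le) n

theorem tendsto_div_of_hasDerivAt {𝕜 : Type*} [NontriviallyNormedField 𝕜] {f g : 𝕜 → 𝕜}
    {a f' g' : 𝕜} (hf : HasDerivAt f f' a) (hg : HasDerivAt g g' a) (hfa : f a = 0) (hga : g a = 0)
    (hg' : g' ≠ 0) : Tendsto (fun z => f z / g z) (𝓝[≠] a) (𝓝 (f' / g')) := by
  refine (hf.tendsto_slope.div hg.tendsto_slope hg').congr' ?_
  filter_upwards [self_mem_nhdsWithin] with z hz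
  rw [Pi.div_apply, slope_def_field, slope_def_field, hfa, hga, sub_zero, sub_zero,
    div_div_div_cancel_right₀ (sub_ne_zero.mpr hz)]

theorem cos_natCast_mul_pi (n : ℕ) : Complex.cos (n * Real.pi) = (-1) ^ n := by
  exact_mod_cast congrArg Complex.ofReal (Real.cos_nat_mul_pi n)

theorem sin_natCast_mul_pi (n : ℕ) : Complex.sin (n * Real.pi) = 0 := by
  exact_mod_cast congrArg Complex.ofReal (Real.sin_nat_mul_pi n)

theorem hasDerivAt_sin_mul_pi (n : ℕ) :
    HasDerivAt (fun ν : ℂ => Complex.sin (ν * Real.pi)) ((-1) ^ n * Real.pi) n := by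
  rw [← cos_natCast_mul_pi]
  simpa using ((hasDerivAt_id (n : ℂ)).mul_const (Real.pi : ℂ)).csin

theorem neg_one_pow_mul_pi_ne_zero (n : ℕ) : (-1 : ℂ) ^ n * Real.pi ≠ 0 :=
  mul_ne_zero (pow_ne_zero n (neg_ne_zero.mpr one_ne_zero))
    (Complex.ofReal_ne_zero.mpr Real.pi_ne_zero)

theorem tendsto_legendreQ_legendreQNat (n : ℕ) {x : ℝ} (hx : x ∈ Ioo (-1) 1) :
    Tendsto (fun ν : ℂ => legendreQ ν x) (𝓝[≠] (n : ℂ)) (𝓝 (legendreQNat n x)) := by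
  have hnum : Differentiable ℂ fun ν : ℂ =>
      Complex.cos (ν * Real.pi) * legendreP ν x - legendreP ν (-x) :=
    ((by fun_prop : Differentiable ℂ fun ν : ℂ => Complex.cos (ν * Real.pi)).mul
      (differentiable_legendreP_degree hx)).sub
      (differentiable_legendreP_degree (neg_mem_Ioo_neg_one_one hx))
  have hquot := tendsto_div_of_hasDerivAt (hnum n).hasDerivAt (hasDerivAt_sin_mul_pi n)
    (by rw [cos_natCast_mul_pi, legendreP_natCast_neg, sub_self]) (sin_natCast_mul_pi n)
    (neg_one_pow_mul_pi_ne_zero n)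
  refine tendsto_nhds_limUnder ⟨_, (hquot.const_mul (Real.pi / 2 : ℂ)).congr fun ν => ?_⟩
  rw [legendreQ, div_mul_div_comm, mul_div_right_comm]

theorem continuous_legendreProd_degree {x : ℝ} (hx : x ∈ Ioo (-1) 1) :
    Continuous fun ν => legendreProd ν x := by
  simp only [legendreProd_ofReal]
  exact (differentiable_legendreP_degree hx).continuous.mul
    (differentiable_legendreP_degree (neg_mem_Ioo_neg_one_one hx)).continuous

theorem continuous_legendreHilbertTransform_degree {x : ℝ} (hx : x ∈ Ioo (-1) 1) :
    Continuous fun ν => legendreHilbertTransform ν x := by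
  refine continuous_iff_continuousAt.mpr fun ν₀ => ContinuousAt.add ?_
    ((continuous_legendreProd_degree hx).mul_const _).continuousAt
  obtain ⟨φ, hφ, hle⟩ := exists_norm_legendreProd_sub_div_sub_le hx (‖ν₀‖ + 1)
  refine intervalIntegral.tendsto_integral_filter_of_dominated_convergence φ
    (Eventually.of_forall fun ν => aestronglyMeasurable_legendreProd_sub_div_sub ν x) ?_ hφ ?_
  · filter_upwards [Metric.isOpen_ball.mem_nhds (mem_ball_zero_iff.mpr (lt_add_one ‖ν₀‖))] with ν hν
    exact (ae_restrict_iff' measurableSet_uIoc).mp (ae_restrict_uIoc_of_forall_mem_Ioo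
      (by norm_num) (hle ν (mem_ball_zero_iff.mp hν).le))
  · exact (ae_restrict_iff' measurableSet_uIoc).mp (ae_restrict_uIoc_of_forall_mem_Ioo
      (by norm_num) fun ξ hξ => (((continuous_legendreProd_degree hξ).sub
        (continuous_legendreProd_degree hx)).div_const _).continuousAt)

theorem legendreHilbertTransform_eq_legendreQ_mul {ν : ℂ} {x : ℝ}
    (hν : Complex.sin (ν * Real.pi) ≠ 0) (hx : x ∈ Ioo (-1) 1) :
    legendreHilbertTransform ν x =
      legendreQ ν x * (Complex.cos (ν * Real.pi) * legendreP ν x + legendreP ν (-x)) +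
        Real.pi / 2 * (Complex.sin (ν * Real.pi) * legendreP ν x ^ 2) := by
  have hcos : Complex.cos (ν * Real.pi) ^ 2 = 1 - Complex.sin (ν * Real.pi) ^ 2 :=
    Complex.cos_sq' _
  rw [legendreHilbertTransform_eq hν hx, legendreQ]
  generalize Complex.cos (ν * Real.pi) = c at hcos ⊢
  generalize Complex.sin (ν * Real.pi) = s at hν hcos ⊢
  field_simp
  linear_combination -legendreP ν x ^ 2 * hcos

theorem legendreHilbertTransform_natCast (n : ℕ) {x : ℝ} (hx : x ∈ Ioo (-1) 1) :
    legendreHilbertTransform n x = 2 * (-1) ^ n * (legendreP n x * legendreQNat n x) := by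
  have hP := (differentiable_legendreP_degree hx).continuous
  have hPneg := (differentiable_legendreP_degree (neg_mem_Ioo_neg_one_one hx)).continuous
  have hfactor : Tendsto
      (fun ν => Complex.cos (ν * Real.pi) * legendreP ν x + legendreP ν (-x)) (𝓝[≠] (n : ℂ))
      (𝓝 (2 * (-1) ^ n * legendreP n x)) := by
    refine (Continuous.tendsto' (by fun_prop) _ _ ?_).mono_left nhdsWithin_le_nhds
    rw [cos_natCast_mul_pi, legendreP_natCast_neg]
    ring
  have hremainder : Tendsto
      (fun ν => Complex.sin (ν * Real.pi) * legendreP ν x ^ 2) (𝓝[≠] (n : ℂ)) (𝓝 0) := by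
    refine (Continuous.tendsto' (by fun_prop) _ _ ?_).mono_left nhdsWithin_le_nhds
    rw [sin_natCast_mul_pi, zero_mul]
  have hlim := ((tendsto_legendreQ_legendreQNat n hx).mul hfactor).add
    (hremainder.const_mul (Real.pi / 2 : ℂ))
  have hcont := ((continuous_legendreHilbertTransform_degree hx).tendsto n).mono_left
    (nhdsWithin_le_nhds (s := {(n : ℂ)}ᶜ))
  rw [tendsto_nhds_unique hcont (hlim.congr' ?_)]
  · ring
  · filter_upwards [(hasDerivAt_sin_mul_pi n).eventually_ne (c := 0)
      (neg_one_pow_mul_pi_ne_zero n)] with ν hν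
    exact (legendreHilbertTransform_eq_legendreQ_mul hν hx).symm

theorem hasPrincipalValue_legendreP_sq (n : ℕ) {x : ℝ} (hx : x ∈ Ioo (-1) 1) :
    HasPrincipalValue (fun ξ : ℝ => legendreP n ξ ^ 2 / (2 * ((x : ℂ) - ξ))) (-1) 1 x
      (legendreP n x * legendreQNat n x) := by
  have hsign : (-1 : ℂ) ^ n * (-1) ^ n = 1 := by rw [← mul_pow]; simp
  convert! (hasPrincipalValue_legendreHilbertTransform n hx).const_mul ((-1) ^ n / 2) using 1
  · ext ξ
    rw [legendreProd_ofReal, legendreP_natCast_neg, div_mul_div_comm]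
    linear_combination -(legendreP n ξ ^ 2 / (2 * ((x : ℂ) - ξ))) * hsign
  · rw [legendreHilbertTransform_natCast n hx]
    linear_combination -(legendreP n x * legendreQNat n x) * hsign

end IntegerDegree

theorem mainTheorem3 :
    (∀ ν : ℂ, (∀ k : ℤ, ν ≠ (k : ℂ)) → ∀ x : ℝ, -1 < x → x < 1 →
      HasPrincipalValue
        (fun ξ : ℝ => 2 * legendreP ν ξ * legendreP ν (-ξ) / ((Real.pi : ℂ) * ((x : ℂ) - (ξ : ℂ))))
        (-1) 1 x
        ((legendreP ν x ^ 2 - legendreP ν (-x) ^ 2) / Complex.sin (ν * Real.pi))) ∧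
    (∀ n : ℕ, ∀ x : ℝ, -1 < x → x < 1 →
      Filter.Tendsto (fun ν : ℂ => legendreQ ν x) (nhdsWithin (n : ℂ) {(n : ℂ)}ᶜ)
        (nhds (legendreQNat n x)) ∧
      HasPrincipalValue
        (fun ξ : ℝ => legendreP (n : ℂ) ξ ^ 2 / (2 * ((x : ℂ) - (ξ : ℂ))))
        (-1) 1 x (legendreP (n : ℂ) x * legendreQNat n x) ∧
      HasPrincipalValue
        (fun ξ : ℝ => legendreP (-(n : ℂ) - 1) ξ ^ 2 / (2 * ((x : ℂ) - (ξ : ℂ))))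
        (-1) 1 x (legendreP (n : ℂ) x * legendreQNat n x)) := by
  refine ⟨fun ν hν x h₁ h₂ => hasPrincipalValue_legendreP_mul_legendreP_neg hν ⟨h₁, h₂⟩,
    fun n x h₁ h₂ => ⟨tendsto_legendreQ_legendreQNat n ⟨h₁, h₂⟩,
      hasPrincipalValue_legendreP_sq n ⟨h₁, h₂⟩, ?_⟩⟩
  rw [legendreP_neg_sub_one]
  exact hasPrincipalValue_legendreP_sq n ⟨h₁, h₂⟩
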